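/- A monoidal comonad in a monoidal category $\langle\mathcal A,\otimes,I,a,l,r\rangle$, with $a_{A,B,C}:(A\otimes B)\otimes C\to A\otimes(B\otimes C)$, $l_A:I\otimes A\to A$, $r_A:A\otimes I\to A$, is a comonad $\langle L,\varepsilon,\delta\rangle$ in $\mathcal A$ together with a natural transformation with components $\psi_{A,B}:LA\otimes LB\to L(A\otimes B)$ and an arrow $\psi_0:I\to LI$ which make $L$ a (lax) monoidal functor, \[ La_{A,B,C}\circ\psi_{A\otimes B,C}\circ(\psi_{A,B}\otimes \mathbf 1_{LC})=\psi_{A,B\otimes C}\circ(\mathbf 1_{LA}\otimes\psi_{B,C})\circ a_{LA,LB,LC}, \] \[ Ll_A\circ\psi_{I,A}\circ(\psi_0\otimes\mathbf 1_{LA})=l_{LA},\qquad Lr_A\circ\psi_{A,I}\circ(\mathbf 1_{LA}\otimes\psi_0)=r_{LA}, \] and for which $\varepsilon$ and $\delta$ are monoidal natural transformations, \[ \varepsilon_{A\otimes B}\circ\psi_{A,B}=\varepsilon_A\otimes\varepsilon_B,\qquad \delta_{A\otimes B}\circ\psi_{A,B}=L\psi_{A,B}\circ\psi_{LA,LB}\circ(\delta_A\otimes\delta_B),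 \] \[ \varepsilon_I\circ\psi_0=\mathbf 1_I,\qquad \delta_I\circ\psi_0=L\psi_0\circ\psi_0. \] Let $P$ be an arbitrary set, and let $\mathcal{MS}^{co}$ be the category of the monoidal comonad freely generated by $P$: its objects are the formulae built from the elements of $P$ and $I$ with $\otimes$ and $L$, and its arrows are the terms built from $\mathbf 1_A$, $a_{A,B,C}$, $l_A$, $r_A$ and their inverses, $\varepsilon_A$, $\delta_A$, $\psi_{A,B}$, $\psi_0$ with composition, $\otimes$ and $L$, modulo the least congruence that contains the equations of monoidal comonads. Let $\mathit{Rel}$ be the category whose objects are the finite ordinals $n=\{0,\dots,n-1\}$ and whose arrows $m\to n$ are all relations $R\subseteq m\times n$. The functor $G:\mathcal{MS}^{co}\to\mathit{Rel}$ sends a formula $A$ to the number $GA$ of occurrences of $L$ in $A$, these occurrences being numbered from right to left, beginning with $0$. On arrows it is given inductively as follows. - $G\mathbf 1_A$, and $G$ of $a_{A,B,C}$, $l_A$, $r_A$ and their inverses, are identity relations. - $G(g\circ f)$ is the composite of the relations $Gf$ and $Gg$. $G(f\otimes g)$ is the disjoint juxtaposition of $Gf$ (on the left) and $Gg$ (on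 the right). $G(Lf)$ is $Gf$ together with the pair that links the two outermost occurrences of $L$. - $G\varepsilon_A:GA+1\to GA$ is $\{(x,x): x<GA\}$. - $G\delta_A:GA+1\to GA+2$ is $\{(x,x): x<GA\}\cup\{(GA,GA),(GA,GA+1)\}$. - $G\psi_{A,B}$ links the outermost $L$ of $LA$ and the outermost $L$ of $LB$ both to the outermost $L$ of $L(A\otimes B)$, and links every other occurrence of $L$, in $A$ or in $B$, to the same occurrence in the target. - $G\psi_0:0\to 1$ is the empty relation. Then the functor $G$ is faithful: if $f,g:A\to B$ are arrows of $\mathcal{MS}^{co}$ with $Gf=Gg$, then $f=g$. -/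

import Mathlib

open CategoryTheory MonoidalCategory

universe u

/-! ### The category of relations between finite ordinals -/

/-- Finite ordinals, as objects of the category of relations between them: the object `⟨n⟩` stands
for the finite ordinal `n = {0, …, n - 1}`. -/
structure FinRel : Type where
  card : ℕ

namespace FinRel

/-- An arrow `m → n` is an arbitrary relation between `{0, …, m - 1}` and `{0, …, n - 1}`. -/
@[ext]
structure Hom (m n : FinRel) : Type where
  rel : SetRel (Fin m.card) (Fin n.card)

instance : Category FinRel where
  Hom := Hom
  id _ := ⟨SetRel.id⟩
  comp R S := ⟨R.rel.comp S.rel⟩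
  id_comp R := Hom.ext (SetRel.id_comp R.rel)
  comp_id R := Hom.ext (SetRel.comp_id R.rel)
  assoc R S T := Hom.ext (SetRel.comp_assoc R.rel S.rel T.rel)

end FinRel

/-! ### The monoidal comonad freely generated by a set of objects -/

/-- Objects of the monoidal comonad freely generated by the set of objects `P`: the formulae built
from the elements of `P` and the unit object by tensor and by the endofunctor `L`. -/
inductive MSco (P : Type u) : Type u
  | of (p : P) : MSco P
  | unit : MSco P
  | tensor (A B : MSco P) : MSco P
  | L (A : MSco P) : MSco P

namespace MSco

variable {P : Type u}

/-- Arrow terms. The term `f.comp g` is the composite "first `f`, then `g`". -/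
inductive Term : MSco P → MSco P → Type u
  | id (A : MSco P) : Term A A
  | comp {A B C : MSco P} (f : Term A B) (g : Term B C) : Term A C
  | tensor {A A' B B' : MSco P} (f : Term A A') (g : Term B B') :
      Term (A.tensor B) (A'.tensor B')
  | a (A B C : MSco P) : Term ((A.tensor B).tensor C) (A.tensor (B.tensor C))
  | aInv (A B C : MSco P) : Term (A.tensor (B.tensor C)) ((A.tensor B).tensor C)
  | l (A : MSco P) : Term (unit.tensor A) A
  | lInv (A : MSco P) : Term A (unit.tensor A)
  | r (A : MSco P) : Term (A.tensor unit) A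
  | rInv (A : MSco P) : Term A (A.tensor unit)
  | map {A B : MSco P} (f : Term A B) : Term A.L B.L
  | ε (A : MSco P) : Term A.L A
  | δ (A : MSco P) : Term A.L A.L.L
  | ψ (A B : MSco P) : Term (A.L.tensor B.L) (A.tensor B).L
  | ψ₀ : Term unit unit.L

/-- Provable equality of arrow terms: the least congruence that contains the equations of monoidal
comonads. -/
inductive Term.Eqv : {A B : MSco P} → Term A B → Term A B → Prop
  -- equivalence and congruence
  | refl {A B} (f : Term A B) : Eqv f f
  | symm {A B} {f g : Term A B} : Eqv f g → Eqv g f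
  | trans {A B} {f g h : Term A B} : Eqv f g → Eqv g h → Eqv f h
  | comp_congr {A B C} {f f' : Term A B} {g g' : Term B C} :
      Eqv f f' → Eqv g g' → Eqv (f.comp g) (f'.comp g')
  | tensor_congr {A A' B B'} {f f' : Term A A'} {g g' : Term B B'} :
      Eqv f f' → Eqv g g' → Eqv (f.tensor g) (f'.tensor g')
  | map_congr {A B} {f f' : Term A B} : Eqv f f' → Eqv f.map f'.map
  -- category
  | id_comp {A B} (f : Term A B) : Eqv ((Term.id A).comp f) f
  | comp_id {A B} (f : Term A B) : Eqv (f.comp (Term.id B)) f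
  | assoc {A B C D} (f : Term A B) (g : Term B C) (h : Term C D) :
      Eqv ((f.comp g).comp h) (f.comp (g.comp h))
  -- monoidal category
  | tensor_id (A B) : Eqv ((Term.id A).tensor (Term.id B)) (Term.id (A.tensor B))
  | tensor_comp {A A' A'' B B' B''} (f : Term A A') (f' : Term A' A'') (g : Term B B')
      (g' : Term B' B'') :
      Eqv ((f.tensor g).comp (f'.tensor g')) ((f.comp f').tensor (g.comp g'))
  | a_aInv (A B C) : Eqv ((Term.a A B C).comp (Term.aInv A B C)) (Term.id _)
  | aInv_a (A B C) : Eqv ((Term.aInv A B C).comp (Term.a A B C)) (Term.id _)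
  | l_lInv (A) : Eqv ((Term.l A).comp (Term.lInv A)) (Term.id _)
  | lInv_l (A) : Eqv ((Term.lInv A).comp (Term.l A)) (Term.id _)
  | r_rInv (A) : Eqv ((Term.r A).comp (Term.rInv A)) (Term.id _)
  | rInv_r (A) : Eqv ((Term.rInv A).comp (Term.r A)) (Term.id _)
  | a_nat {A A' B B' C C'} (f : Term A A') (g : Term B B') (h : Term C C') :
      Eqv (((f.tensor g).tensor h).comp (Term.a A' B' C'))
        ((Term.a A B C).comp (f.tensor (g.tensor h)))
  | l_nat {A B} (f : Term A B) :
      Eqv (((Term.id unit).tensor f).comp (Term.l B)) ((Term.l A).comp f)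
  | r_nat {A B} (f : Term A B) :
      Eqv ((f.tensor (Term.id unit)).comp (Term.r B)) ((Term.r A).comp f)
  | pentagon (A B C D) :
      Eqv (((Term.a A B C).tensor (Term.id D)).comp
          ((Term.a A (B.tensor C) D).comp ((Term.id A).tensor (Term.a B C D))))
        ((Term.a (A.tensor B) C D).comp (Term.a A B (C.tensor D)))
  | triangle (A B) :
      Eqv ((Term.a A unit B).comp ((Term.id A).tensor (Term.l B)))
        ((Term.r A).tensor (Term.id B))
  -- endofunctor
  | map_id (A) : Eqv (Term.id A).map (Term.id A.L)
  | map_comp {A B C} (f : Term A B) (g : Term B C) : Eqv (f.comp g).map (f.map.comp g.map)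
  -- monoidal functor
  | ψ_nat {A A' B B'} (f : Term A A') (g : Term B B') :
      Eqv ((f.map.tensor g.map).comp (Term.ψ A' B')) ((Term.ψ A B).comp (f.tensor g).map)
  | ψ_a (A B C) :
      Eqv (((Term.ψ A B).tensor (Term.id C.L)).comp
          ((Term.ψ (A.tensor B) C).comp (Term.a A B C).map))
        ((Term.a A.L B.L C.L).comp
          (((Term.id A.L).tensor (Term.ψ B C)).comp (Term.ψ A (B.tensor C))))
  | ψ_l (A) :
      Eqv ((Term.ψ₀.tensor (Term.id A.L)).comp ((Term.ψ unit A).comp (Term.l A).map)) (Term.l A.L)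
  | ψ_r (A) :
      Eqv (((Term.id A.L).tensor Term.ψ₀).comp ((Term.ψ A unit).comp (Term.r A).map)) (Term.r A.L)
  -- comonad
  | ε_nat {A B} (f : Term A B) : Eqv (f.map.comp (Term.ε B)) ((Term.ε A).comp f)
  | δ_nat {A B} (f : Term A B) : Eqv (f.map.comp (Term.δ B)) ((Term.δ A).comp f.map.map)
  | coassoc (A) : Eqv ((Term.δ A).comp (Term.δ A).map) ((Term.δ A).comp (Term.δ A.L))
  | left_counit (A) : Eqv ((Term.δ A).comp (Term.ε A.L)) (Term.id A.L)
  | right_counit (A) : Eqv ((Term.δ A).comp (Term.ε A).map) (Term.id A.L)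
  -- `ε` and `δ` are monoidal natural transformations
  | ψ_ε (A B) : Eqv ((Term.ψ A B).comp (Term.ε (A.tensor B))) ((Term.ε A).tensor (Term.ε B))
  | ψ_δ (A B) :
      Eqv ((Term.ψ A B).comp (Term.δ (A.tensor B)))
        (((Term.δ A).tensor (Term.δ B)).comp ((Term.ψ A.L B.L).comp (Term.ψ A B).map))
  | ψ₀_ε : Eqv (Term.ψ₀.comp (Term.ε unit)) (Term.id unit)
  | ψ₀_δ : Eqv (Term.ψ₀.comp (Term.δ unit)) (Term.ψ₀.comp Term.ψ₀.map)

instance termSetoid (A B : MSco P) : Setoid (Term A B) where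
  r := Term.Eqv
  iseqv := ⟨Term.Eqv.refl, Term.Eqv.symm, Term.Eqv.trans⟩

/-- Arrows are the equivalence classes of arrow terms under provable equality. -/
instance category : Category (MSco P) where
  Hom A B := Quotient (termSetoid A B)
  id A := Quotient.mk _ (Term.id A)
  comp := Quotient.map₂ Term.comp fun _ _ hf _ _ hg => Term.Eqv.comp_congr hf hg
  id_comp := by
    rintro A B ⟨f⟩
    exact Quotient.sound (Term.Eqv.id_comp f)
  comp_id := by
    rintro A B ⟨f⟩
    exact Quotient.sound (Term.Eqv.comp_id f)
  assoc := by
    rintro A B C D ⟨f⟩ ⟨g⟩ ⟨h⟩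
    exact Quotient.sound (Term.Eqv.assoc f g h)

/-- The arrow named by an arrow term. -/
def Term.toHom {A B : MSco P} (f : Term A B) : A ⟶ B := Quotient.mk (termSetoid A B) f

theorem Term.Eqv.toHom_eq {A B : MSco P} {f g : Term A B} (h : Term.Eqv f g) :
    f.toHom = g.toHom := Quotient.sound h

/-! The next instances record that the category just built does carry a monoidal comonad. -/

instance monoidalCategoryStruct : MonoidalCategoryStruct (MSco P) where
  tensorObj := tensor
  tensorUnit := unit
  tensorHom := Quotient.map₂ Term.tensor fun _ _ hf _ _ hg => Term.Eqv.tensor_congr hf hg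
  whiskerLeft A _ _ := Quotient.map (fun g => (Term.id A).tensor g)
    fun _ _ hg => Term.Eqv.tensor_congr (Term.Eqv.refl _) hg
  whiskerRight f B := Quotient.map (fun f => f.tensor (Term.id B))
    (fun _ _ hf => Term.Eqv.tensor_congr hf (Term.Eqv.refl _)) f
  associator A B C := ⟨(Term.a A B C).toHom, (Term.aInv A B C).toHom,
    (Term.Eqv.a_aInv A B C).toHom_eq, (Term.Eqv.aInv_a A B C).toHom_eq⟩
  leftUnitor A := ⟨(Term.l A).toHom, (Term.lInv A).toHom,
    (Term.Eqv.l_lInv A).toHom_eq, (Term.Eqv.lInv_l A).toHom_eq⟩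
  rightUnitor A := ⟨(Term.r A).toHom, (Term.rInv A).toHom,
    (Term.Eqv.r_rInv A).toHom_eq, (Term.Eqv.rInv_r A).toHom_eq⟩

instance monoidalCategory : MonoidalCategory (MSco P) :=
  MonoidalCategory.ofTensorHom
    (id_tensorHom_id := fun A B => (Term.Eqv.tensor_id A B).toHom_eq)
    (id_tensorHom := by rintro A B B' ⟨g⟩; rfl)
    (tensorHom_id := by rintro A A' ⟨f⟩ B; rfl)
    (tensorHom_comp_tensorHom := by
      rintro A A' A'' B B' B'' ⟨f⟩ ⟨g⟩ ⟨f'⟩ ⟨g'⟩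
      exact (Term.Eqv.tensor_comp f f' g g').toHom_eq)
    (associator_naturality := by
      rintro A B C A' B' C' ⟨f⟩ ⟨g⟩ ⟨h⟩
      exact (Term.Eqv.a_nat f g h).toHom_eq)
    (leftUnitor_naturality := by
      rintro A B ⟨f⟩
      exact (Term.Eqv.l_nat f).toHom_eq)
    (rightUnitor_naturality := by
      rintro A B ⟨f⟩
      exact (Term.Eqv.r_nat f).toHom_eq)
    (pentagon := fun A B C D => (Term.Eqv.pentagon A B C D).toHom_eq)
    (triangle := fun A B => (Term.Eqv.triangle A B).toHom_eq)

/-- The endofunctor `L`. -/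
def functorL (P : Type u) : MSco P ⥤ MSco P where
  obj := L
  map := Quotient.map Term.map fun _ _ hf => Term.Eqv.map_congr hf
  map_id A := (Term.Eqv.map_id A).toHom_eq
  map_comp := by
    rintro A B C ⟨f⟩ ⟨g⟩
    exact (Term.Eqv.map_comp f g).toHom_eq

instance laxMonoidalL : (functorL P).LaxMonoidal where
  ε := Term.ψ₀.toHom
  μ A B := (Term.ψ A B).toHom
  μ_natural_left := by
    rintro A A' ⟨f⟩ B
    exact ((Term.Eqv.tensor_congr (Term.Eqv.refl _) (Term.Eqv.map_id B).symm).comp_congr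
      (Term.Eqv.refl _)).toHom_eq.trans (Term.Eqv.ψ_nat f (Term.id B)).toHom_eq
  μ_natural_right := by
    rintro A A' B ⟨g⟩
    exact ((Term.Eqv.tensor_congr (Term.Eqv.map_id B).symm (Term.Eqv.refl _)).comp_congr
      (Term.Eqv.refl _)).toHom_eq.trans (Term.Eqv.ψ_nat (Term.id B) g).toHom_eq
  associativity A B C := (Term.Eqv.ψ_a A B C).toHom_eq
  left_unitality A := (Term.Eqv.ψ_l A).symm.toHom_eq
  right_unitality A := (Term.Eqv.ψ_r A).symm.toHom_eq

/-- The comonad `⟨L, ε, δ⟩`. -/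
def comonadL (P : Type u) : Comonad (MSco P) where
  toFunctor := functorL P
  ε :=
    { app := fun A => (Term.ε A).toHom
      naturality := by
        rintro A B ⟨f⟩
        exact (Term.Eqv.ε_nat f).toHom_eq }
  δ :=
    { app := fun A => (Term.δ A).toHom
      naturality := by
        rintro A B ⟨f⟩
        exact (Term.Eqv.δ_nat f).toHom_eq }
  coassoc A := (Term.Eqv.coassoc A).toHom_eq
  left_counit A := (Term.Eqv.left_counit A).toHom_eq
  right_counit A := (Term.Eqv.right_counit A).toHom_eq

instance laxMonoidalComonadL : (comonadL P).toFunctor.LaxMonoidal := laxMonoidalL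

instance isMonoidal_ε : NatTrans.IsMonoidal (comonadL P).ε where
  unit := Term.Eqv.ψ₀_ε.toHom_eq
  tensor A B := ((Term.Eqv.ψ_ε A B).trans (Term.Eqv.comp_id _).symm).toHom_eq

instance isMonoidal_δ : NatTrans.IsMonoidal (comonadL P).δ where
  unit := Term.Eqv.ψ₀_δ.toHom_eq
  tensor A B := (Term.Eqv.ψ_δ A B).toHom_eq

/-! ### The functor `G` into relations between finite ordinals -/

/-- The number of occurrences of `L` in a formula. These occurrences are numbered from right to
left, beginning with `0`; so in `A ⊗ B` the occurrences in `B` come first, and in `L A` the outermost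
`L` has the number `count A`. -/
def count : MSco P → ℕ
  | of _ => 0
  | unit => 0
  | tensor A B => B.count + A.count
  | L A => A.count + 1

/-- The relation between (numbers of) occurrences of `L` in the source and in the target of an
arrow term. -/
def Term.graph : {A B : MSco P} → Term A B → ℕ → ℕ → Prop
  | _, _, .id A => fun x y => x = y ∧ x < A.count
  | _, _, .comp f g => fun x z => ∃ y, f.graph x y ∧ g.graph y z
  | _, _, .tensor (B := B) (B' := B') f g => fun x y =>
      g.graph x y ∨ ∃ i j, f.graph i j ∧ x = B.count + i ∧ y = B'.count + j
  | _, _, .a A B C => fun x y => x = y ∧ x < ((A.tensor B).tensor C).count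
  | _, _, .aInv A B C => fun x y => x = y ∧ x < ((A.tensor B).tensor C).count
  | _, _, .l A => fun x y => x = y ∧ x < A.count
  | _, _, .lInv A => fun x y => x = y ∧ x < A.count
  | _, _, .r A => fun x y => x = y ∧ x < A.count
  | _, _, .rInv A => fun x y => x = y ∧ x < A.count
  | _, _, .map (A := A) (B := B) f => fun x y => f.graph x y ∨ (x = A.count ∧ y = B.count)
  | _, _, .ε A => fun x y => x = y ∧ x < A.count
  | _, _, .δ A => fun x y =>
      (x = y ∧ x < A.count) ∨ (x = A.count ∧ (y = A.count ∨ y = A.count + 1))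
  -- the two outermost occurrences of `L` in `L A ⊗ L B` are both linked to the one of `L (A ⊗ B)`
  | _, _, .ψ A B => fun x y =>
      (x = y ∧ x < B.count) ∨
      (x = y + 1 ∧ B.count < x ∧ x < B.count + 1 + A.count) ∨
      ((x = B.count ∨ x = B.count + 1 + A.count) ∧ y = B.count + A.count)
  | _, _, .ψ₀ => fun _ _ => False

theorem Term.graph_lt {A B : MSco P} (f : Term A B) {x y : ℕ} (h : f.graph x y) :
    x < A.count ∧ y < B.count := by
  induction f generalizing x y <;> simp only [Term.graph, count] at h ⊢ <;> grind

theorem exists_shift_iff (F : ℕ → ℕ → Prop) (m n x y : ℕ) :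
    (∃ i j, F i j ∧ x = m + i ∧ y = n + j) ↔ m ≤ x ∧ n ≤ y ∧ F (x - m) (y - n) := by
  constructor
  · rintro ⟨i, j, h, rfl, rfl⟩
    simpa using h
  · rintro ⟨h₁, h₂, h⟩
    exact ⟨_, _, h, by omega, by omega⟩

set_option linter.unusedSimpArgs false in
theorem Term.Eqv.graph_eq {A B : MSco P} {f g : Term A B} (h : Term.Eqv f g) (x y : ℕ) :
    f.graph x y ↔ g.graph x y := by
  induction h generalizing x y with
  | refl f => rfl
  | symm _ ih => exact (ih x y).symm
  | trans _ _ ih₁ ih₂ => exact (ih₁ x y).trans (ih₂ x y)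
  | comp_congr _ _ ih₁ ih₂ => simp only [Term.graph, ih₁, ih₂]
  | tensor_congr _ _ ih₁ ih₂ => simp only [Term.graph, ih₁, ih₂]
  | map_congr _ ih => simp only [Term.graph, ih]
  | id_comp f =>
    have lf := fun x y => f.graph_lt (x := x) (y := y)
    simp only [Term.graph, count, or_and_right, and_or_left, exists_or, and_assoc,
      exists_and_left, exists_eq_left, exists_eq_left', exists_false, false_or, or_false, false_and,
      and_false]
    grind
  | comp_id f =>
    have lf := fun x y => f.graph_lt (x := x) (y := y)
    simp only [Term.graph, count, or_and_right, and_or_left, exists_or, and_assoc,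
      exists_and_left, exists_eq_left, exists_eq_left', exists_false, false_or, or_false, false_and,
      and_false]
    grind
  | assoc =>
    simp only [Term.graph, count, or_and_right, and_or_left, exists_or, and_assoc,
      exists_and_left, exists_eq_left, exists_eq_left', exists_false, false_or, or_false, false_and,
      and_false]
    grind
  | tensor_id =>
    simp only [Term.graph, count, exists_shift_iff]
    omega
  | tensor_comp f f' g g' =>
    have lf := fun x y => f.graph_lt (x := x) (y := y)
    have lf' := fun x y => f'.graph_lt (x := x) (y := y)
    have lg := fun x y => g.graph_lt (x := x) (y := y)
    have lg' := fun x y => g'.graph_lt (x := x) (y := y)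
    simp only [Term.graph, count, exists_shift_iff]
    constructor
    · rintro ⟨z, h₁ | h₁, h₂ | h₂⟩
      · exact .inl ⟨z, h₁, h₂⟩
      · have := lg _ _ h₁
        omega
      · have := lg' _ _ h₂
        omega
      · exact .inr ⟨h₁.1, h₂.2.1, _, h₁.2.2, h₂.2.2⟩
    · rintro (⟨z, h₁, h₂⟩ | ⟨hx, hy, z, h₁, h₂⟩)
      · exact ⟨z, .inl h₁, .inl h₂⟩
      · exact ⟨_, .inr ⟨hx, Nat.le_add_right _ z, by simpa using h₁⟩,
          .inr ⟨Nat.le_add_right _ z, hy, by simpa using h₂⟩⟩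
  | a_aInv =>
    simp only [Term.graph, count, or_and_right, and_or_left, exists_or, and_assoc,
      exists_and_left, exists_eq_left, exists_eq_left', exists_false, false_or, or_false, false_and,
      and_false]
    grind
  | aInv_a =>
    simp only [Term.graph, count, or_and_right, and_or_left, exists_or, and_assoc,
      exists_and_left, exists_eq_left, exists_eq_left', exists_false, false_or, or_false, false_and,
      and_false]
    grind
  | l_lInv =>
    simp only [Term.graph, count, or_and_right, and_or_left, exists_or, and_assoc,
      exists_and_left, exists_eq_left, exists_eq_left', exists_false, false_or, or_false, false_and,
      and_false]
    grind
  | lInv_l =>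
    simp only [Term.graph, count, or_and_right, and_or_left, exists_or, and_assoc,
      exists_and_left, exists_eq_left, exists_eq_left', exists_false, false_or, or_false, false_and,
      and_false]
    grind
  | r_rInv =>
    simp only [Term.graph, count, or_and_right, and_or_left, exists_or, and_assoc,
      exists_and_left, exists_eq_left, exists_eq_left', exists_false, false_or, or_false, false_and,
      and_false]
    grind
  | rInv_r =>
    simp only [Term.graph, count, or_and_right, and_or_left, exists_or, and_assoc,
      exists_and_left, exists_eq_left, exists_eq_left', exists_false, false_or, or_false, false_and,
      and_false]
    grind
  | a_nat f g h =>
    have lf := fun x y => f.graph_lt (x := x) (y := y)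
    have lg := fun x y => g.graph_lt (x := x) (y := y)
    have lh := fun x y => h.graph_lt (x := x) (y := y)
    simp only [Term.graph, count, or_and_right, and_or_left, exists_or, and_assoc,
      exists_and_left, exists_eq_left, exists_eq_left', exists_false, false_or, or_false, false_and,
      and_false]
    grind
  | l_nat f =>
    have lf := fun x y => f.graph_lt (x := x) (y := y)
    simp only [Term.graph, count, or_and_right, and_or_left, exists_or, and_assoc,
      exists_and_left, exists_eq_left, exists_eq_left', exists_false, false_or, or_false, false_and,
      and_false]
    grind
  | r_nat f =>
    have lf := fun x y => f.graph_lt (x := x) (y := y)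
    simp only [Term.graph, count, or_and_right, and_or_left, exists_or, and_assoc,
      exists_and_left, exists_eq_left, exists_eq_left', exists_false, false_or, or_false, false_and,
      and_false]
    grind
  | pentagon =>
    simp only [Term.graph, count, exists_shift_iff]
    constructor
    · rintro ⟨_, h₁, _, h₂, h₃⟩
      exact ⟨x, by omega⟩
    · rintro ⟨_, h₁, h₂⟩
      exact ⟨x, by omega, x, by omega⟩
  | triangle =>
    simp only [Term.graph, count, exists_shift_iff]
    constructor
    · rintro ⟨_, h₁, h₂⟩
      omega
    · intro h
      exact ⟨x, by omega⟩
  | map_id =>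
    simp only [Term.graph, count, or_and_right, and_or_left, exists_or, and_assoc,
      exists_and_left, exists_eq_left, exists_eq_left', exists_false, false_or, or_false, false_and,
      and_false]
    grind
  | map_comp f g =>
    have lf := fun x y => f.graph_lt (x := x) (y := y)
    have lg := fun x y => g.graph_lt (x := x) (y := y)
    simp only [Term.graph, count, or_and_right, and_or_left, exists_or, and_assoc,
      exists_and_left, exists_eq_left, exists_eq_left', exists_false, false_or, or_false, false_and,
      and_false]
    grind
  | @ψ_nat A A' B B' f g =>
    have lf := fun x y => f.graph_lt (x := x) (y := y)
    have lg := fun x y => g.graph_lt (x := x) (y := y)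
    simp only [Term.graph, count, exists_shift_iff]
    constructor
    · rintro ⟨z, (h₁ | h₁) | ⟨hx, hz, h₁ | h₁⟩, h₂⟩
      · have := lg _ _ h₁
        obtain rfl : z = y := by omega
        exact ⟨x, by omega, .inl (.inl h₁)⟩
      · exact ⟨B.count + A.count, by omega, by omega⟩
      · have := lf _ _ h₁
        obtain ⟨i, rfl⟩ := Nat.exists_eq_add_of_le hx
        obtain ⟨j, rfl⟩ := Nat.exists_eq_add_of_le hz
        obtain rfl : y = B'.count + j := by omega
        exact ⟨B.count + i, by omega, .inl (.inr ⟨by omega, by omega, by simpa using h₁⟩)⟩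
      · exact ⟨B.count + A.count, by omega, by omega⟩
    · rintro ⟨z, h₁, (h₂ | ⟨hz, hy, h₂⟩) | h₂⟩
      · have := lg _ _ h₂
        obtain rfl : x = z := by omega
        exact ⟨y, .inl (.inl h₂), by omega⟩
      · have := lf _ _ h₂
        obtain ⟨i, rfl⟩ := Nat.exists_eq_add_of_le hz
        obtain ⟨j, rfl⟩ := Nat.exists_eq_add_of_le hy
        obtain rfl : x = B.count + 1 + i := by omega
        exact ⟨B'.count + 1 + j, .inr ⟨by omega, by omega, .inl (by simpa using h₂)⟩, by omega⟩
      · by_cases hx : x = B.count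
        · exact ⟨B'.count, .inl (.inr ⟨hx, rfl⟩), by omega⟩
        · exact ⟨B'.count + 1 + A'.count, .inr ⟨by omega, by omega, .inr (by omega)⟩, by omega⟩
  | ψ_a A B C =>
    simp only [Term.graph, count, exists_shift_iff]
    constructor
    · rintro ⟨_, h₁, _, h₂, h₃⟩
      refine ⟨x, by omega, ?_⟩
      by_cases c₁ : x < C.count
      · exact ⟨x, by omega⟩
      by_cases c₂ : x = C.count
      · exact ⟨C.count + B.count, by omega⟩
      · exact ⟨x - 1, by omega⟩
    · rintro ⟨_, h₁, _, h₂, h₃⟩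
      by_cases c₁ : x < C.count + 1
      · refine ⟨x, by omega, y, by omega⟩
      by_cases c₂ : x < C.count + 1 + B.count
      · refine ⟨x, by omega, y, by omega⟩
      by_cases c₃ : x = C.count + 1 + B.count
      · exact ⟨C.count + 1 + (B.count + A.count), by omega, y, by omega⟩
      · exact ⟨x - 1, by omega, y, by omega⟩
  | ψ_l =>
    simp only [Term.graph, count, or_and_right, and_or_left, exists_or, and_assoc,
      exists_and_left, exists_eq_left, exists_eq_left', exists_false, false_or, or_false, false_and,
      and_false]
    grind
  | ψ_r =>
    simp only [Term.graph, count, exists_shift_iff]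
    simp only [false_or]
    constructor
    · rintro ⟨_, h₁, _, h₂, h₃⟩
      omega
    · intro h
      exact ⟨x + 1, by omega, x, by omega⟩
  | ε_nat f =>
    have lf := fun x y => f.graph_lt (x := x) (y := y)
    simp only [Term.graph, count, or_and_right, and_or_left, exists_or, and_assoc,
      exists_and_left, exists_eq_left, exists_eq_left', exists_false, false_or, or_false, false_and,
      and_false]
    grind
  | δ_nat f =>
    have lf := fun x y => f.graph_lt (x := x) (y := y)
    simp only [Term.graph, count, or_and_right, and_or_left, exists_or, and_assoc,
      exists_and_left, exists_eq_left, exists_eq_left', exists_false, false_or, or_false, false_and,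
      and_false]
    grind
  | coassoc =>
    simp only [Term.graph, count, or_and_right, and_or_left, exists_or, and_assoc,
      exists_and_left, exists_eq_left, exists_eq_left', exists_false, false_or, or_false, false_and,
      and_false]
    grind
  | left_counit =>
    simp only [Term.graph, count, or_and_right, and_or_left, exists_or, and_assoc,
      exists_and_left, exists_eq_left, exists_eq_left', exists_false, false_or, or_false, false_and,
      and_false]
    grind
  | right_counit =>
    simp only [Term.graph, count, or_and_right, and_or_left, exists_or, and_assoc,
      exists_and_left, exists_eq_left, exists_eq_left', exists_false, false_or, or_false, false_and,
      and_false]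
    grind
  | ψ_ε =>
    simp only [Term.graph, count, exists_shift_iff]
    constructor
    · rintro ⟨_, h₁, h₂⟩
      omega
    · intro h
      exact ⟨y, by omega⟩
  | ψ_δ A B =>
    simp only [Term.graph, count, exists_shift_iff]
    constructor
    · rintro ⟨z, h₁, h₂⟩
      by_cases c₁ : x < B.count
      · exact ⟨x, by omega, x, by omega⟩
      by_cases c₂ : x = B.count
      · by_cases c₃ : y = B.count + A.count
        · exact ⟨B.count, by omega, B.count, by omega⟩
        · exact ⟨B.count + 1, by omega, B.count + 1 + (A.count + 1), by omega⟩
      by_cases c₃ : y = B.count + A.count + 1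
      · exact ⟨B.count + 1 + 1 + (A.count + 1), by omega, y + 1, by omega⟩
      · exact ⟨y + 1 + 1, by omega, y + 1, by omega⟩
    · rintro ⟨_, h₁, _, h₂, h₃⟩
      by_cases c₁ : x < B.count
      · exact ⟨x, by omega⟩
      by_cases c₂ : x = B.count
      · exact ⟨B.count + A.count, by omega⟩
      · exact ⟨x - 1, by omega⟩
  | ψ₀_ε =>
    simp only [Term.graph, count, or_and_right, and_or_left, exists_or, and_assoc,
      exists_and_left, exists_eq_left, exists_eq_left', exists_false, false_or, or_false, false_and,
      and_false]
    grind
  | ψ₀_δ =>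
    simp only [Term.graph, count, or_and_right, and_or_left, exists_or, and_assoc,
      exists_and_left, exists_eq_left, exists_eq_left', exists_false, false_or, or_false, false_and,
      and_false]

/-- `G` on arrow terms. -/
def Term.G {A B : MSco P} (f : Term A B) : (⟨A.count⟩ : FinRel) ⟶ ⟨B.count⟩ :=
  FinRel.Hom.mk {p | f.graph p.1 p.2}

/-- The functor `G` from the free monoidal comonad to the category of relations between finite
ordinals. -/
def G (P : Type u) : MSco P ⥤ FinRel where
  obj A := ⟨A.count⟩
  map := Quotient.lift Term.G fun f g h => FinRel.Hom.ext (by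
    ext ⟨x, y⟩
    exact Term.Eqv.graph_eq h x y)
  map_id A := FinRel.Hom.ext (by
    ext ⟨x, y⟩
    exact ⟨fun h => Fin.ext h.1, fun h => ⟨congrArg Fin.val h, x.2⟩⟩)
  map_comp := by
    rintro A B C ⟨f⟩ ⟨g⟩
    refine FinRel.Hom.ext ?_
    ext ⟨x, z⟩
    constructor
    · rintro ⟨y, hf, hg⟩
      exact ⟨⟨y, (f.graph_lt hf).2⟩, hf, hg⟩
    · rintro ⟨y, hf, hg⟩
      exact ⟨y, hf, hg⟩

end MSco

/-! The proof is a cut elimination followed by induction on the target. Call an arrow an opening if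
it is built from counits and the monoidal structure (`Op`). By `red`, every arrow `X ⟶ B` is an
opening followed by a step read off from `B`: a tensor of two arrows if `B` is a tensor, and a
promotion `coact Y h ≫ box g` if `B` is a box, where `coact` is the coalgebra structure on a formula
`Y` whose letters are all under some `L`. Into a letter or the unit there are only openings.

The opening can be made canonical. An `L` removed by a counit is linked to nothing, while a
promotion links every outermost `L` of `Y` to the outermost `L` of the target. Hence `f` factors
through `nf X (dom f)`, which opens the unlinked boxes from the outside until only linked boxes and
letters are left, and flattens the result to a list (`factor`, `factor_box`). This opening depends
only on the graph of `f`; the key fact is `Op.pre_nf`, which makes `nf` compatible with all openings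
and contains coherence for monoidal categories.

Two arrows with the same graph therefore share their first factor, and it cancels at the level of
graphs (`Op.gr_cancel`). For a target `L B`, the counit recovers the promoted arrow (`promote_eps`).
For a target `B ⊗ C`, the list has to be cut at the same place for both arrows (`split_unique`):
each entry has a letter or a linked outermost `L`. Letters are invisible to `G`, but their number is
preserved by every arrow. -/

namespace MSco

variable {P : Type u}

/-! ### Graphs of arrows -/

/-- The relation on natural numbers underlying `G`. -/
def gr {A B : MSco P} (f : A ⟶ B) : ℕ → ℕ → Prop :=
  Quotient.lift Term.graph (fun _ _ h => funext₂ fun x y => propext (Term.Eqv.graph_eq h x y)) f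

theorem gr_lt {A B : MSco P} {f : A ⟶ B} {x y : ℕ} (h : gr f x y) :
    x < A.count ∧ y < B.count := by
  obtain ⟨f⟩ := f
  exact f.graph_lt h

/-- The counit of the comonad. -/
abbrev eps (A : MSco P) : A.L ⟶ A := (Term.ε A).toHom

/-- The comultiplication of the comonad. -/
abbrev del (A : MSco P) : A.L ⟶ A.L.L := (Term.δ A).toHom

/-- The monoidal structure of the endofunctor. -/
abbrev psi (A B : MSco P) : A.L ⊗ B.L ⟶ (A ⊗ B).L := (Term.ψ A B).toHom

/-- The unit of the monoidal endofunctor. -/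
abbrev psiUnit : 𝟙_ (MSco P) ⟶ (𝟙_ (MSco P)).L := Term.ψ₀.toHom

/-- The endofunctor on arrows. -/
def box {A B : MSco P} (f : A ⟶ B) : A.L ⟶ B.L := (functorL P).map f

theorem box_id (A : MSco P) : box (𝟙 A) = 𝟙 A.L := (functorL P).map_id A

theorem box_comp {A B C : MSco P} (f : A ⟶ B) (g : B ⟶ C) : box (f ≫ g) = box f ≫ box g :=
  (functorL P).map_comp f g

@[simp] theorem count_tensor (A B : MSco P) : (A ⊗ B).count = B.count + A.count := rfl
@[simp] theorem count_unit : (𝟙_ (MSco P)).count = 0 := rfl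

theorem gr_id (A : MSco P) (x y : ℕ) : gr (𝟙 A) x y ↔ x = y ∧ x < A.count := Iff.rfl

theorem gr_comp {A B C : MSco P} (f : A ⟶ B) (g : B ⟶ C) (x z : ℕ) :
    gr (f ≫ g) x z ↔ ∃ y, gr f x y ∧ gr g y z := by
  obtain ⟨f⟩ := f
  obtain ⟨g⟩ := g
  exact Iff.rfl

theorem gr_tensor {A A' B B' : MSco P} (f : A ⟶ A') (g : B ⟶ B') (x y : ℕ) :
    gr (f ⊗ₘ g) x y ↔
      gr g x y ∨ ∃ i j, gr f i j ∧ x = B.count + i ∧ y = B'.count + j := by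
  obtain ⟨f⟩ := f
  obtain ⟨g⟩ := g
  exact Iff.rfl

theorem gr_box {A B : MSco P} (f : A ⟶ B) (x y : ℕ) :
    gr (box f) x y ↔ gr f x y ∨ (x = A.count ∧ y = B.count) := by
  obtain ⟨f⟩ := f
  exact Iff.rfl

theorem gr_eps (A : MSco P) (x y : ℕ) : gr (eps A) x y ↔ x = y ∧ x < A.count := Iff.rfl

theorem gr_associator_inv (A B C : MSco P) (x y : ℕ) :
    gr (α_ A B C).inv x y ↔ x = y ∧ x < ((A ⊗ B) ⊗ C).count := Iff.rfl

theorem gr_rightUnitor_inv (A : MSco P) (x y : ℕ) :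
    gr (ρ_ A).inv x y ↔ x = y ∧ x < A.count := Iff.rfl

/-- The number of occurrences of generating objects in a formula. -/
def letters : MSco P → ℕ
  | of _ => 1
  | unit => 0
  | tensor A B => A.letters + B.letters
  | L A => A.letters

/-- An invariant that the graph does not see. In `split_unique` it decides to which side of a tensor
an entry with a letter belongs. -/
theorem Term.letters_eq {A B : MSco P} (f : Term A B) : A.letters = B.letters := by
  induction f with
  | id => rfl
  | comp _ _ ih ih' => exact ih.trans ih'
  | tensor _ _ ih ih' => exact congrArg₂ (· + ·) ih ih'
  | map _ ih => exact ih
  | _ => simp only [letters, Nat.add_assoc, Nat.zero_add, Nat.add_zero]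

theorem letters_eq {A B : MSco P} (f : A ⟶ B) : A.letters = B.letters := by
  have h := fun t : Term A B => t.letters_eq
  obtain ⟨t⟩ := f
  exact h t

/-! ### Equations in terms of arrows -/

theorem eps_natural {A B : MSco P} (f : A ⟶ B) : box f ≫ eps B = eps A ≫ f :=
  (comonadL P).ε.naturality f

theorem del_natural {A B : MSco P} (f : A ⟶ B) : box f ≫ del B = del A ≫ box (box f) :=
  (comonadL P).δ.naturality f

theorem psi_natural {A A' B B' : MSco P} (f : A ⟶ A') (g : B ⟶ B') :
    (box f ⊗ₘ box g) ≫ psi A' B' = psi A B ≫ box (f ⊗ₘ g) := by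
  obtain ⟨f⟩ := f
  obtain ⟨g⟩ := g
  exact (Term.Eqv.ψ_nat f g).toHom_eq

theorem psi_del (A B : MSco P) :
    psi A B ≫ del (A ⊗ B) = (del A ⊗ₘ del B) ≫ psi A.L B.L ≫ box (psi A B) :=
  (Term.Eqv.ψ_δ A B).toHom_eq

theorem psi_eps (A B : MSco P) : psi A B ≫ eps (A ⊗ B) = eps A ⊗ₘ eps B :=
  (Term.Eqv.ψ_ε A B).toHom_eq

theorem psi_assoc (A B C : MSco P) :
    (psi A B ▷ C.L) ≫ psi (A ⊗ B) C ≫ box (α_ A B C).hom =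
      (α_ A.L B.L C.L).hom ≫ (A.L ◁ psi B C) ≫ psi A (B ⊗ C) :=
  (Term.Eqv.ψ_a A B C).toHom_eq

theorem psi_left (A : MSco P) :
    (psiUnit ▷ A.L) ≫ psi (𝟙_ _) A ≫ box (λ_ A).hom = (λ_ A.L).hom :=
  (Term.Eqv.ψ_l A).toHom_eq

theorem psi_right (A : MSco P) :
    (A.L ◁ psiUnit) ≫ psi A (𝟙_ _) ≫ box (ρ_ A).hom = (ρ_ A.L).hom :=
  (Term.Eqv.ψ_r A).toHom_eq

/-! ### Coalgebra structures -/

/-- Formulae all of whose generating objects are in the scope of some `L`. -/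
def Boxed : MSco P → Prop
  | of _ => False
  | unit => True
  | tensor A B => A.Boxed ∧ B.Boxed
  | L _ => True

/-- The coalgebra structure of a boxed formula. -/
def coact : (A : MSco P) → A.Boxed → (A ⟶ A.L)
  | of _, h => h.elim
  | unit, _ => psiUnit
  | tensor A B, h => (coact A h.1 ⊗ₘ coact B h.2) ≫ psi A B
  | L A, _ => del A

/-- With `coact_del`, this makes every boxed formula a coalgebra. The tensor case is where
monoidality of `ε`, and of `δ` for the other law, enters. -/
theorem coact_eps : (A : MSco P) → (h : A.Boxed) → coact A h ≫ eps A = 𝟙 A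
  | of _, h => h.elim
  | unit, _ => Term.Eqv.ψ₀_ε.toHom_eq
  | tensor A B, h => by
    have hA := coact_eps A h.1
    have hB := coact_eps B h.2
    change ((coact A h.1 ⊗ₘ coact B h.2) ≫ psi A B) ≫ eps (A ⊗ B) = 𝟙 (A ⊗ B)
    rw [Category.assoc, psi_eps, tensorHom_comp_tensorHom, hA, hB, id_tensorHom_id]
  | L A, _ => (Term.Eqv.left_counit A).toHom_eq

theorem coact_del : (A : MSco P) → (h : A.Boxed) →
    coact A h ≫ del A = coact A h ≫ box (coact A h)
  | of _, h => h.elim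
  | unit, _ => Term.Eqv.ψ₀_δ.toHom_eq
  | tensor A B, h => by
    have hA := coact_del A h.1
    have hB := coact_del B h.2
    change ((coact A h.1 ⊗ₘ coact B h.2) ≫ psi A B) ≫ del (A ⊗ B) =
      ((coact A h.1 ⊗ₘ coact B h.2) ≫ psi A B) ≫ box ((coact A h.1 ⊗ₘ coact B h.2) ≫ psi A B)
    generalize coact A h.1 = c at *
    generalize coact B h.2 = c' at *
    rw [Category.assoc, psi_del, tensorHom_comp_tensorHom_assoc, hA, hB, box_comp,
      ← tensorHom_comp_tensorHom_assoc, Category.assoc, ← reassoc_of% psi_natural]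
  | L A, _ => (Term.Eqv.coassoc A).symm.toHom_eq

/-- Promotion is undone by the counit. This eliminates a cut with `ε` and also makes promotion
injective, on arrows and on graphs. -/
theorem promote_eps {X B : MSco P} (h : X.Boxed) (f : X ⟶ B) :
    coact X h ≫ box f ≫ eps B = f := by
  rw [eps_natural, reassoc_of% coact_eps X h]

/-- A promoted arrow is a coalgebra morphism to the cofree coalgebra, so a cut with `δ` amounts to
promoting a second time. -/
theorem promote_del {X B : MSco P} (h : X.Boxed) (f : X ⟶ B) :
    (coact X h ≫ box f) ≫ del B = coact X h ≫ box (coact X h ≫ box f) := by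
  rw [Category.assoc, del_natural, reassoc_of% coact_del X h, box_comp]

/-! ### Openings -/

/-- The arrows generated by the counit and the monoidal structure. -/
inductive Op : {X Y : MSco P} → (X ⟶ Y) → Prop
  | id (X : MSco P) : Op (𝟙 X)
  | comp {X Y Z : MSco P} {e : X ⟶ Y} {e' : Y ⟶ Z} : Op e → Op e' → Op (e ≫ e')
  | tensor {X X' Y Y' : MSco P} {e : X ⟶ X'} {e' : Y ⟶ Y'} : Op e → Op e' → Op (e ⊗ₘ e')
  | associator_hom (A B C : MSco P) : Op (α_ A B C).hom
  | associator_inv (A B C : MSco P) : Op (α_ A B C).inv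
  | leftUnitor_hom (A : MSco P) : Op (λ_ A).hom
  | leftUnitor_inv (A : MSco P) : Op (λ_ A).inv
  | rightUnitor_hom (A : MSco P) : Op (ρ_ A).hom
  | rightUnitor_inv (A : MSco P) : Op (ρ_ A).inv
  | eps (A : MSco P) : Op (eps A)

theorem Op.functional {X Y : MSco P} {e : X ⟶ Y} (he : Op e) {x y y' : ℕ}
    (h : gr e x y) (h' : gr e x y') : y = y' := by
  induction he generalizing x y y' with
  | comp _ _ ih ih' =>
    rw [gr_comp] at h h'
    obtain ⟨z, h₁, h₂⟩ := h
    obtain ⟨z', h₁', h₂'⟩ := h'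
    obtain rfl := ih h₁ h₁'
    exact ih' h₂ h₂'
  | @tensor X X' Y Y' e e' _ _ ih ih' =>
    rw [gr_tensor] at h h'
    rcases h with h | ⟨i, j, h, rfl, rfl⟩ <;> rcases h' with h' | ⟨i', j', h', hx, rfl⟩
    · exact ih' h h'
    · have := (gr_lt h).1
      omega
    · have := (gr_lt h').1
      omega
    · obtain rfl : i = i' := by omega
      rw [ih h h']
  | _ =>
    obtain ⟨rfl, -⟩ := h
    exact h'.1

theorem Op.surjective {X Y : MSco P} {e : X ⟶ Y} (he : Op e) {y : ℕ} (hy : y < Y.count) :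
    ∃ x, gr e x y := by
  induction he generalizing y with
  | comp _ _ ih ih' =>
    obtain ⟨z, hz⟩ := ih' hy
    obtain ⟨x, hx⟩ := ih (gr_lt hz).1
    exact ⟨x, (gr_comp ..).2 ⟨z, hx, hz⟩⟩
  | @tensor X X' Y Y' e e' _ _ ih ih' =>
    by_cases h : y < Y'.count
    · obtain ⟨x, hx⟩ := ih' h
      exact ⟨x, (gr_tensor ..).2 (.inl hx)⟩
    · have h' : y - Y'.count < X'.count := by
        rw [count_tensor] at hy
        omega
      obtain ⟨x, hx⟩ := ih h'
      exact ⟨_, (gr_tensor ..).2 (.inr ⟨x, _, hx, rfl, by omega⟩)⟩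
  | associator_hom A B C =>
    refine ⟨y, rfl, lt_of_lt_of_eq hy ?_⟩
    simp only [count]
    exact add_assoc ..
  | associator_inv A B C => exact ⟨y, rfl, hy⟩
  | leftUnitor_inv A => exact ⟨y, rfl, by simp only [count_tensor, count_unit] at hy ⊢; omega⟩
  | rightUnitor_inv A => exact ⟨y, rfl, by simp only [count_tensor, count_unit] at hy ⊢; omega⟩
  | _ => exact ⟨y, rfl, hy⟩

/-- The graph of an opening is a partial function onto the target, hence an epimorphism of
relations. -/
theorem Op.gr_cancel {X Y Z : MSco P} {e : X ⟶ Y} (he : Op e) {f g : Y ⟶ Z}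
    (h : gr (e ≫ f) = gr (e ≫ g)) : gr f = gr g := by
  have key : ∀ {f g : Y ⟶ Z}, gr (e ≫ f) = gr (e ≫ g) → ∀ y z, gr f y z → gr g y z := by
    intro f g h y z hf
    obtain ⟨x, hx⟩ := he.surjective (gr_lt hf).1
    have : gr (e ≫ g) x z := h ▸ (gr_comp ..).2 ⟨y, hx, hf⟩
    obtain ⟨y', hy', hg⟩ := (gr_comp ..).1 this
    rwa [he.functional hx hy']
  exact funext₂ fun y z => propext ⟨key h y z, key h.symm y z⟩

/-! ### Every arrow is reducible -/

/-- The arrows that are in normal form, up to the composition with an opening. -/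
def Red : (B : MSco P) → {X : MSco P} → (X ⟶ B) → Prop
  | of _, _, f => Op f
  | unit, _, f => Op f
  | tensor B B', X, f => ∃ (Y Y' : MSco P) (e : X ⟶ Y ⊗ Y') (g : Y ⟶ B) (g' : Y' ⟶ B'),
      Op e ∧ Red B g ∧ Red B' g' ∧ f = e ≫ (g ⊗ₘ g')
  | L B, X, f => ∃ (Y : MSco P) (h : Y.Boxed) (e : X ⟶ Y) (g : Y ⟶ B),
      Op e ∧ Red B g ∧ f = e ≫ coact Y h ≫ box g

theorem Op.comp_red {X Y : MSco P} {e : X ⟶ Y} (he : Op e) :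
    (B : MSco P) → {f : Y ⟶ B} → Red B f → Red B (e ≫ f)
  | of _, _, h => he.comp h
  | unit, _, h => he.comp h
  | .tensor _ _, _, ⟨Z, Z', e', g, g', he', hg, hg', hf⟩ =>
    ⟨Z, Z', e ≫ e', g, g', he.comp he', hg, hg', by rw [hf, Category.assoc]⟩
  | L _, _, ⟨Z, h, e', g, he', hg, hf⟩ =>
    ⟨Z, h, e ≫ e', g, he.comp he', hg, by rw [hf, Category.assoc]⟩

theorem red_id : (A : MSco P) → Red A (𝟙 A)
  | of _ => .id _
  | unit => .id _
  | tensor A B => ⟨A, B, 𝟙 (A ⊗ B), 𝟙 A, 𝟙 B, .id _, red_id A, red_id B, by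
      rw [id_tensorHom_id, Category.comp_id]; rfl⟩
  -- The right counit law exhibits the identity of a box as the promotion of its counit.
  | L A => ⟨A.L, trivial, 𝟙 A.L, eps A, .id _, by
      simpa using (Op.eps A).comp_red A (red_id A),
      (Term.Eqv.right_counit A).symm.toHom_eq.trans (Category.id_comp _).symm⟩

theorem Red.tensorHom {B B' X X' : MSco P} {f : X ⟶ B} {f' : X' ⟶ B'} (h : Red B f)
    (h' : Red B' f') : Red (B ⊗ B') (f ⊗ₘ f') :=
  ⟨X, X', 𝟙 _, f, f', .id _, h, h', (Category.id_comp _).symm⟩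

theorem Red.promote {B X : MSco P} {f : X ⟶ B} (h : Red B f) (hX : X.Boxed) :
    Red B.L (coact X hX ≫ box f) :=
  ⟨X, hX, 𝟙 _, f, .id _, h, (Category.id_comp _).symm⟩

/-- Cut elimination: the last step of `f` is known from its target, and each generator either acts
on its components or cancels against it; any opening set free moves to the left. -/
theorem Red.comp_term {B C : MSco P} (t : Term B C) {X : MSco P} {f : X ⟶ B} (hf : Red B f) :
    Red C (f ≫ t.toHom) := by
  induction t generalizing X with
  | id A => exact (Category.comp_id f).symm ▸ hf
  | @comp A B C s t ihs iht =>
    have := iht (ihs hf)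
    rw [Category.assoc] at this
    exact this
  | @tensor A A' B B' s t ihs iht =>
    obtain ⟨Y, Y', e, g, g', he, hg, hg', rfl⟩ := hf
    change Red (A' ⊗ B') ((e ≫ (g ⊗ₘ g')) ≫ (s.toHom ⊗ₘ t.toHom))
    rw [Category.assoc, tensorHom_comp_tensorHom]
    exact he.comp_red _ ((ihs hg).tensorHom (iht hg'))
  | a A B C =>
    obtain ⟨Y, Z, e, g, k, he, ⟨U, V, e', g, g', he', hg, hg', rfl⟩, hk, rfl⟩ := hf
    change Red (A ⊗ B ⊗ C) ((e ≫ ((e' ≫ (g ⊗ₘ g')) ⊗ₘ k)) ≫ (α_ A B C).hom)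
    have : (e ≫ ((e' ≫ (g ⊗ₘ g')) ⊗ₘ k)) ≫ (α_ A B C).hom =
        (e ≫ (e' ⊗ₘ 𝟙 Z) ≫ (α_ U V Z).hom) ≫ (g ⊗ₘ (g' ⊗ₘ k)) := by
      rw [Category.assoc, Category.assoc, Category.assoc, ← associator_naturality,
        tensorHom_comp_tensorHom_assoc, Category.id_comp]
    rw [this]
    exact (he.comp ((he'.tensor (.id _)).comp (.associator_hom ..))).comp_red _
      (hg.tensorHom (hg'.tensorHom hk))
  | aInv A B C =>
    obtain ⟨Z, Y, e, k, g, he, hk, ⟨U, V, e', g, g', he', hg, hg', rfl⟩, rfl⟩ := hf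
    change Red ((A ⊗ B) ⊗ C) ((e ≫ (k ⊗ₘ (e' ≫ (g ⊗ₘ g')))) ≫ (α_ A B C).inv)
    have : (e ≫ (k ⊗ₘ (e' ≫ (g ⊗ₘ g')))) ≫ (α_ A B C).inv =
        (e ≫ (𝟙 Z ⊗ₘ e') ≫ (α_ Z U V).inv) ≫ ((k ⊗ₘ g) ⊗ₘ g') := by
      rw [Category.assoc, Category.assoc, Category.assoc, ← associator_inv_naturality,
        tensorHom_comp_tensorHom_assoc, Category.id_comp]
    rw [this]
    exact (he.comp (((Op.id _).tensor he').comp (.associator_inv ..))).comp_red _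
      ((hk.tensorHom hg).tensorHom hg')
  | l A =>
    obtain ⟨Y, Z, e, g, k, he, hg, hk, rfl⟩ := hf
    change Red A ((e ≫ (g ⊗ₘ k)) ≫ (λ_ A).hom)
    -- The component `g` into the unit is itself an opening, so it can be absorbed on the left
    -- together with the unitor.
    have : (e ≫ (g ⊗ₘ k)) ≫ (λ_ A).hom = (e ≫ (g ⊗ₘ 𝟙 Z) ≫ (λ_ Z).hom) ≫ k := by
      rw [Category.assoc, Category.assoc, Category.assoc, ← leftUnitor_naturality,
        ← id_tensorHom, tensorHom_comp_tensorHom_assoc, Category.id_comp]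
      erw [Category.comp_id]
    rw [this]
    exact (he.comp ((Op.tensor hg (.id _)).comp (.leftUnitor_hom _))).comp_red _ hk
  | lInv A =>
    change Red (𝟙_ _ ⊗ A) (f ≫ (λ_ A).inv)
    rw [leftUnitor_inv_naturality, ← id_tensorHom]
    exact (Op.leftUnitor_inv _).comp_red _ (Red.tensorHom (Op.id _ : Red unit _) hf)
  | r A =>
    obtain ⟨Y, Z, e, g, k, he, hg, hk, rfl⟩ := hf
    change Red A ((e ≫ (g ⊗ₘ k)) ≫ (ρ_ A).hom)
    have : (e ≫ (g ⊗ₘ k)) ≫ (ρ_ A).hom = (e ≫ (𝟙 Y ⊗ₘ k) ≫ (ρ_ Y).hom) ≫ g := by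
      rw [Category.assoc, Category.assoc, Category.assoc, ← rightUnitor_naturality,
        ← tensorHom_id, tensorHom_comp_tensorHom_assoc, Category.id_comp]
      erw [Category.comp_id]
    rw [this]
    exact (he.comp (((Op.id _).tensor hk).comp (.rightUnitor_hom _))).comp_red _ hg
  | rInv A =>
    change Red (A ⊗ 𝟙_ _) (f ≫ (ρ_ A).inv)
    rw [rightUnitor_inv_naturality, ← tensorHom_id]
    exact (Op.rightUnitor_inv _).comp_red _ (hf.tensorHom (Op.id _ : Red unit _))
  | @map A B t ih =>
    obtain ⟨Y, h, e, g, he, hg, rfl⟩ := hf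
    change Red B.L ((e ≫ coact Y h ≫ box g) ≫ box t.toHom)
    rw [Category.assoc, Category.assoc, ← box_comp]
    exact he.comp_red _ ((ih hg).promote h)
  | ε A =>
    obtain ⟨Y, h, e, g, he, hg, rfl⟩ := hf
    rw [Category.assoc, Category.assoc, promote_eps]
    exact he.comp_red _ hg
  | δ A =>
    obtain ⟨Y, h, e, g, he, hg, rfl⟩ := hf
    rw [Category.assoc, promote_del]
    exact he.comp_red _ ((hg.promote h).promote h)
  | ψ A B =>
    obtain ⟨Y, Y', e, f, f', he, ⟨Z, h, e₁, g, he₁, hg, rfl⟩, ⟨Z', h', e₂, g', he₂, hg', rfl⟩,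
      rfl⟩ := hf
    change Red (A ⊗ B).L ((e ≫ ((e₁ ≫ coact Z h ≫ box g) ⊗ₘ (e₂ ≫ coact Z' h' ≫ box g'))) ≫
      psi A B)
    -- Naturality of `psi` merges two promotions into one, since the coalgebra structure of `Z ⊗ Z'`
    -- is the tensor of the two structures followed by `psi`.
    have : (e ≫ ((e₁ ≫ coact Z h ≫ box g) ⊗ₘ (e₂ ≫ coact Z' h' ≫ box g'))) ≫ psi A B =
        (e ≫ (e₁ ⊗ₘ e₂)) ≫ coact (Z ⊗ Z') ⟨h, h'⟩ ≫ box (g ⊗ₘ g') := by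
      change _ = (e ≫ (e₁ ⊗ₘ e₂)) ≫ ((coact Z h ⊗ₘ coact Z' h') ≫ psi Z Z') ≫ box (g ⊗ₘ g')
      rw [Category.assoc, Category.assoc, Category.assoc, ← psi_natural,
        tensorHom_comp_tensorHom_assoc, tensorHom_comp_tensorHom_assoc, Category.assoc,
        Category.assoc]
    rw [this]
    exact (he.comp (he₁.tensor he₂)).comp_red _
      (Red.promote (X := Z ⊗ Z') (hg.tensorHom hg') ⟨h, h'⟩)
  | ψ₀ =>
    have hf : Op f := hf
    -- `psiUnit` is the promotion of the identity of the unit.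
    have := hf.comp_red _ (Red.promote (X := unit) (red_id unit) trivial)
    rw [box_id] at this
    erw [Category.comp_id] at this
    exact this

theorem red {A B : MSco P} (f : A ⟶ B) : Red B f := by
  have := fun t : Term A B => (red_id A).comp_term t
  obtain ⟨t⟩ := f
  have := this t
  rw [Category.id_comp] at this
  exact this

/-! ### Lists of formulae -/

/-- The tensor product of a list of formulae. -/
def prod : List (MSco P) → MSco P
  | [] => unit
  | A :: Γ => tensor A (prod Γ)

/-- Concatenation of lists is sent to the tensor product. -/
def join : (Γ Δ : List (MSco P)) → (prod Γ ⊗ prod Δ ≅ prod (Γ ++ Δ))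
  | [], Δ => λ_ (prod Δ)
  | A :: Γ, Δ => α_ A (prod Γ) (prod Δ) ≪≫ whiskerLeftIso A (join Γ Δ)

theorem join_cons_hom (A : MSco P) (Γ Δ : List (MSco P)) :
    (join (A :: Γ) Δ).hom = (α_ A (prod Γ) (prod Δ)).hom ≫ A ◁ (join Γ Δ).hom := rfl

theorem count_prod_append (Γ Δ : List (MSco P)) :
    (prod (Γ ++ Δ)).count = (prod Δ).count + (prod Γ).count := by
  induction Γ with
  | nil => rfl
  | cons A Γ ih =>
    simp only [List.cons_append, prod, count, ih]
    omega

theorem letters_prod_append (Γ Δ : List (MSco P)) :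
    (prod (Γ ++ Δ)).letters = (prod Γ).letters + (prod Δ).letters :=
  (letters_eq (join Γ Δ).hom).symm

/-- The identity between the products of equal lists. -/
def cast {Γ Δ : List (MSco P)} (h : Γ = Δ) : prod Γ ⟶ prod Δ := eqToHom (congrArg prod h)

theorem cast_cons (A : MSco P) {Γ Δ : List (MSco P)} (h : Γ = Δ) :
    cast (congrArg (A :: ·) h) = A ◁ cast h := by
  subst h
  exact (whiskerLeft_id A (prod Γ)).symm

section

variable {C : Type*} [Category* C] [MonoidalCategory C]

/-- The facts of this section hold in any monoidal category. They supply the induction steps for the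
unit and associativity laws of `join`, and transfer these laws to `Norm.tens`; `c` plays the role of
the identification `cast` of two equal lists. -/
theorem associator_whiskerLeft_rightUnitor (A : C) {X Y : C} (j : X ⊗ 𝟙_ C ⟶ Y) (c : Y ⟶ X)
    (h : j ≫ c = (ρ_ X).hom) :
    ((α_ A X (𝟙_ C)).hom ≫ A ◁ j) ≫ A ◁ c = (ρ_ (A ⊗ X)).hom := by
  rw [Category.assoc, ← whiskerLeft_comp, h, rightUnitor_tensor_hom]

theorem leftUnitor_whiskerRight_comp {X Y Z : C} (j : X ⊗ Y ⟶ Z) :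
    (λ_ X).hom ▷ Y ≫ j ≫ 𝟙 Z = (α_ (𝟙_ C) X Y).hom ≫ 𝟙_ C ◁ j ≫ (λ_ Z).hom := by
  rw [leftUnitor_naturality]
  simp

theorem associator_whiskerLeft_associator (A : C) {X Y Z XY YZ U V : C} (j₁ : X ⊗ Y ⟶ XY)
    (j₂ : XY ⊗ Z ⟶ U) (c : U ⟶ V) (j₃ : Y ⊗ Z ⟶ YZ) (j₄ : X ⊗ YZ ⟶ V)
    (h : j₁ ▷ Z ≫ j₂ ≫ c = (α_ X Y Z).hom ≫ X ◁ j₃ ≫ j₄) :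
    ((α_ A X Y).hom ≫ A ◁ j₁) ▷ Z ≫ ((α_ A XY Z).hom ≫ A ◁ j₂) ≫ A ◁ c =
      (α_ (A ⊗ X) Y Z).hom ≫ (A ⊗ X) ◁ j₃ ≫ (α_ A X YZ).hom ≫ A ◁ j₄ := by
  have := congrArg (A ◁ ·) h
  simp only [whiskerLeft_comp] at this
  simp only [comp_whiskerRight, Category.assoc, associator_naturality_middle_assoc, this]
  simp

theorem tensorHom_comp_associator {X Y Z X' Y' Z' XY YZ U V : C} (f : X ⟶ X') (g : Y ⟶ Y')
    (h : Z ⟶ Z') (j₁ : X' ⊗ Y' ⟶ XY) (j₂ : XY ⊗ Z' ⟶ U) (c : U ⟶ V) (j₃ : Y' ⊗ Z' ⟶ YZ)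
    (j₄ : X' ⊗ YZ ⟶ V)
    (e : j₁ ▷ Z' ≫ j₂ ≫ c = (α_ X' Y' Z').hom ≫ X' ◁ j₃ ≫ j₄) :
    ((((f ⊗ₘ g) ≫ j₁) ⊗ₘ h) ≫ j₂) ≫ c =
      (α_ X Y Z).hom ≫ (f ⊗ₘ ((g ⊗ₘ h) ≫ j₃)) ≫ j₄ := by
  have h₁ : ((f ⊗ₘ g) ≫ j₁) ⊗ₘ h = ((f ⊗ₘ g) ⊗ₘ h) ≫ j₁ ▷ Z' := by
    rw [← tensorHom_id, tensorHom_comp_tensorHom, Category.comp_id]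
  have h₂ : f ⊗ₘ ((g ⊗ₘ h) ≫ j₃) = (f ⊗ₘ (g ⊗ₘ h)) ≫ X' ◁ j₃ := by
    rw [← id_tensorHom, tensorHom_comp_tensorHom, Category.comp_id]
  rw [h₁, h₂, Category.assoc, Category.assoc, Category.assoc, e, associator_naturality_assoc]

theorem tensorHom_comp_rightUnitor {X X' Y : C} (f : X ⟶ X') (j : X' ⊗ 𝟙_ C ⟶ Y) (c : Y ⟶ X')
    (h : j ≫ c = (ρ_ X').hom) : ((f ⊗ₘ 𝟙 (𝟙_ C)) ≫ j) ≫ c = (ρ_ X).hom ≫ f := by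
  rw [Category.assoc, h, tensorHom_id, rightUnitor_naturality]

end

theorem join_nil_right (Γ : List (MSco P)) :
    (join Γ []).hom ≫ cast (List.append_nil Γ) = (ρ_ (prod Γ)).hom := by
  induction Γ with
  | nil => exact (Category.comp_id (λ_ (𝟙_ (MSco P))).hom).trans unitors_equal
  | cons A Γ ih =>
    refine Eq.trans ?_ (associator_whiskerLeft_rightUnitor A _ _ ih)
    exact congrArg ((join (A :: Γ) []).hom ≫ ·) (cast_cons A _)

theorem join_assoc (Γ Δ Θ : List (MSco P)) :
    (join Γ Δ).hom ▷ prod Θ ≫ (join (Γ ++ Δ) Θ).hom ≫ cast (List.append_assoc Γ Δ Θ) =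
      (α_ _ _ _).hom ≫ prod Γ ◁ (join Δ Θ).hom ≫ (join Γ (Δ ++ Θ)).hom := by
  induction Γ with
  | nil => exact leftUnitor_whiskerRight_comp (join Δ Θ).hom
  | cons A Γ ih =>
    refine Eq.trans ?_ (associator_whiskerLeft_associator A _ _ _ _ _ ih)
    exact congrArg ((join (A :: Γ) Δ).hom ▷ prod Θ ≫ (join (A :: Γ ++ Δ) Θ).hom ≫ ·)
      (cast_cons A _)

/-! ### Opening the boxes that are not linked -/

/-- An arrow to the tensor product of some list of formulae. -/
abbrev Norm (X : MSco P) : Type u := Σ Γ : List (MSco P), X ⟶ prod Γ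

namespace Norm

/-- Precomposition. -/
def pre {X Y : MSco P} (e : X ⟶ Y) (s : Norm Y) : Norm X := ⟨s.1, e ≫ s.2⟩

/-- Tensor product. -/
def tens {X Y : MSco P} (s : Norm X) (t : Norm Y) : Norm (X ⊗ Y) :=
  ⟨s.1 ++ t.1, (s.2 ⊗ₘ t.2) ≫ (join s.1 t.1).hom⟩

/-- Single formulae. -/
def single (X : MSco P) : Norm X := ⟨[X], (ρ_ X).inv⟩

/-- The empty list. -/
def nil : Norm (𝟙_ (MSco P)) := ⟨[], 𝟙 _⟩

theorem ext {X : MSco P} {s t : Norm X} (h : s.1 = t.1)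
    (h' : s.2 ≫ cast h = t.2) : s = t := by
  obtain ⟨Γ, f⟩ := s
  obtain ⟨Δ, g⟩ := t
  obtain rfl : Γ = Δ := h
  obtain rfl : f = g := (Category.comp_id f).symm.trans h'
  rfl

theorem pre_id {X : MSco P} (s : Norm X) : pre (𝟙 X) s = s := by
  rw [pre, Category.id_comp]

theorem pre_comp {X Y Z : MSco P} (e : X ⟶ Y) (e' : Y ⟶ Z) (s : Norm Z) :
    pre (e ≫ e') s = pre e (pre e' s) := by
  rw [pre, Category.assoc]; rfl

theorem pre_inv {X Y : MSco P} (i : X ≅ Y) {s : Norm X} {t : Norm Y} (h : pre i.hom t = s) :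
    pre i.inv s = t := by
  rw [← h, ← pre_comp, i.inv_hom_id, pre_id]

theorem pre_tens {X X' Y Y' : MSco P} (e : X ⟶ Y) (e' : X' ⟶ Y') (s : Norm Y) (t : Norm Y') :
    pre (e ⊗ₘ e') (tens s t) = tens (pre e s) (pre e' t) := by
  simp only [pre, tens, tensorHom_comp_tensorHom_assoc]

theorem pre_leftUnitor {X : MSco P} (s : Norm X) : pre (λ_ X).hom s = tens nil s := by
  have : (λ_ X).hom ≫ s.2 = (𝟙 _ ⊗ₘ s.2) ≫ (λ_ (prod s.1)).hom := by
    rw [id_tensorHom, leftUnitor_naturality]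
  exact congrArg (Sigma.mk s.1) this

theorem pre_rightUnitor {X : MSco P} (s : Norm X) : pre (ρ_ X).hom s = tens s nil := by
  refine (ext (List.append_nil s.1) ?_).symm
  exact tensorHom_comp_rightUnitor _ _ _ (join_nil_right s.1)

theorem pre_associator {X Y Z : MSco P} (s : Norm X) (t : Norm Y) (w : Norm Z) :
    pre (α_ X Y Z).hom (tens s (tens t w)) = tens (tens s t) w := by
  refine (ext (List.append_assoc s.1 t.1 w.1) ?_).symm
  exact tensorHom_comp_associator _ _ _ _ _ _ _ _ (join_assoc s.1 t.1 w.1)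

end Norm

open Classical in
/-- Opens the outermost boxes that do not belong to `D`, and then those that become outermost. -/
noncomputable def nf : (X : MSco P) → (ℕ → Prop) → Norm X
  | of p, _ => .single (of p)
  | unit, _ => .nil
  | tensor A B, D => .tens (nf A fun i => D (B.count + i)) (nf B D)
  | L A, D => if D A.count then .single A.L else .pre (eps A) (nf A D)

theorem nf_congr : (X : MSco P) → {D D' : ℕ → Prop} → (∀ x < X.count, (D x ↔ D' x)) →
    nf X D = nf X D'
  | of _, _, _, _ => rfl
  | unit, _, _, _ => rfl
  | tensor A B, D, D', h => by
    rw [nf, nf, nf_congr B fun x hx => h x (by simp only [count]; omega),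
      nf_congr A fun x hx => h (B.count + x) (by simp only [count]; omega)]
  | L A, D, D', h => by
    have h' := h A.count (Nat.lt_succ_self _)
    rw [nf, nf, nf_congr A fun x hx => h x (hx.trans (Nat.lt_succ_self _))]
    by_cases hD : D A.count
    · rw [if_pos hD, if_pos (h'.1 hD)]
    · rw [if_neg hD, if_neg fun hD' => hD (h'.2 hD')]

theorem nf_tensor (A B : MSco P) (D : ℕ → Prop) :
    nf (A ⊗ B) D = .tens (nf A fun i => D (B.count + i)) (nf B D) := rfl

theorem pre_associator_nf (A B C : MSco P) (D : ℕ → Prop) :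
    Norm.pre (α_ A B C).hom (nf (A ⊗ B ⊗ C) D) = nf ((A ⊗ B) ⊗ C) D := by
  simp only [nf_tensor, Norm.pre_associator, count_tensor, add_assoc]

theorem nf_tensor_unit (A : MSco P) (D : ℕ → Prop) : nf (A ⊗ 𝟙_ _) D = .tens (nf A D) .nil := by
  rw [nf_tensor]
  simp only [count_unit, zero_add]
  rfl

/-- Here `D` is the preimage of `D'` along the graph of `e`. The structural cases say that
`Norm.tens` is strictly associative and unital, which is coherence by normalization to lists. -/
theorem Op.pre_nf {X Y : MSco P} {e : X ⟶ Y} (he : Op e) {D D' : ℕ → Prop}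
    (h : ∀ x < X.count, (D x ↔ ∃ y, gr e x y ∧ D' y)) : Norm.pre e (nf Y D') = nf X D := by
  induction he generalizing D D' with
  | id X =>
    rw [Norm.pre_id]
    exact (nf_congr X fun x hx => (h x hx).trans ⟨by rintro ⟨_, ⟨rfl, -⟩, h⟩; exact h,
      fun h => ⟨x, ⟨rfl, hx⟩, h⟩⟩).symm
  | @comp X Y Z e e' _ _ ih ih' =>
    rw [Norm.pre_comp, ih' (D := fun y => ∃ z, gr e' y z ∧ D' z) fun _ _ => Iff.rfl]
    refine ih fun x hx => (h x hx).trans ?_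
    simp only [gr_comp]
    grind
  | @tensor X X' Y Y' e e' _ _ ih ih' =>
    rw [nf_tensor, nf_tensor, Norm.pre_tens]
    congr 1
    · refine ih fun x hx => (h _ (by simp only [count_tensor]; omega)).trans ?_
      simp only [gr_tensor]
      constructor
      · rintro ⟨_, h | ⟨i, j, h, hi, rfl⟩, hD⟩
        · have := (gr_lt h).1
          omega
        · obtain rfl : x = i := by omega
          exact ⟨j, h, hD⟩
      · rintro ⟨j, h, hD⟩
        exact ⟨_, .inr ⟨x, j, h, rfl, rfl⟩, hD⟩
    · refine ih' fun x hx => (h x (by simp only [count_tensor]; omega)).trans ?_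
      simp only [gr_tensor]
      constructor
      · rintro ⟨y, h | ⟨i, j, h, hi, rfl⟩, hD⟩
        · exact ⟨y, h, hD⟩
        · omega
      · rintro ⟨j, h, hD⟩
        exact ⟨_, .inl h, hD⟩
  | associator_hom A B C =>
    rw [pre_associator_nf]
    exact (nf_congr _ fun x hx => (h x hx).trans ⟨by rintro ⟨_, ⟨rfl, -⟩, h⟩; exact h,
      fun h => ⟨x, ⟨rfl, hx⟩, h⟩⟩).symm
  | associator_inv A B C =>
    refine Norm.pre_inv _ ((pre_associator_nf ..).trans ?_)
    refine (nf_congr ((A ⊗ B) ⊗ C) fun x hx => (h x ?_).trans ⟨by rintro ⟨_, ⟨rfl, -⟩, h⟩; exact h,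
      fun h => ⟨x, ⟨rfl, hx⟩, h⟩⟩).symm.symm
    simp only [count_tensor] at hx ⊢
    omega
  | leftUnitor_hom A =>
    rw [Norm.pre_leftUnitor]
    exact (nf_congr (𝟙_ _ ⊗ A) fun x hx => (h x hx).trans ⟨by rintro ⟨_, ⟨rfl, -⟩, h⟩; exact h,
      fun h => ⟨x, ⟨rfl, hx⟩, h⟩⟩).symm
  | leftUnitor_inv A =>
    refine Norm.pre_inv _ ((Norm.pre_leftUnitor _).trans ?_)
    exact (nf_congr (𝟙_ _ ⊗ A) fun x hx => (h x hx).trans ⟨by rintro ⟨_, ⟨rfl, -⟩, h⟩; exact h,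
      fun h => ⟨x, ⟨rfl, hx⟩, h⟩⟩)
  | rightUnitor_hom A =>
    rw [Norm.pre_rightUnitor, ← nf_tensor_unit]
    exact (nf_congr _ fun x hx => (h x hx).trans ⟨by rintro ⟨_, ⟨rfl, -⟩, h⟩; exact h,
      fun h => ⟨x, ⟨rfl, by simpa using hx⟩, h⟩⟩).symm
  | rightUnitor_inv A =>
    rw [nf_tensor_unit]
    refine Norm.pre_inv _ ((Norm.pre_rightUnitor _).trans ?_)
    congr 1
    exact (nf_congr A fun x hx => (h x hx).trans ⟨by rintro ⟨_, ⟨rfl, -⟩, h⟩; exact h,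
      fun h => ⟨x, ⟨rfl, hx⟩, h⟩⟩)
  | eps A =>
    -- The counit links the outermost `L` to nothing, so `nf` opens it with this same counit.
    have : ¬ D A.count := by
      rw [h _ (Nat.lt_succ_self _)]
      rintro ⟨_, ⟨-, h⟩, -⟩
      exact h.false
    rw [nf, if_neg this]
    congr 1
    exact (nf_congr A fun x hx => (h x (hx.trans (Nat.lt_succ_self _))).trans
      ⟨by rintro ⟨_, ⟨rfl, -⟩, h⟩; exact h, fun h => ⟨x, ⟨rfl, hx⟩, h⟩⟩).symm

theorem op_join_hom (Γ Δ : List (MSco P)) : Op (join Γ Δ).hom := by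
  induction Γ with
  | nil => exact .leftUnitor_hom _
  | cons A Γ ih =>
    rw [join_cons_hom, ← id_tensorHom]
    exact .comp (.associator_hom ..) (.tensor (.id _) ih)

theorem op_join_inv (Γ Δ : List (MSco P)) : Op (join Γ Δ).inv := by
  induction Γ with
  | nil => exact .leftUnitor_inv _
  | cons A Γ ih =>
    change Op (A ◁ (join Γ Δ).inv ≫ (α_ A (prod Γ) (prod Δ)).inv)
    rw [← id_tensorHom]
    exact .comp (.tensor (.id _) ih) (.associator_inv ..)

theorem nf_L_of_mem {A : MSco P} {D : ℕ → Prop} (h : D A.count) : nf A.L D = .single A.L :=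
  if_pos h

theorem nf_L_of_notMem {A : MSco P} {D : ℕ → Prop} (h : ¬ D A.count) :
    nf A.L D = .pre (eps A) (nf A D) :=
  if_neg h

theorem op_nf : (X : MSco P) → (D : ℕ → Prop) → Op (nf X D).2
  | of _, _ => .rightUnitor_inv _
  | unit, _ => .id _
  | tensor A B, _ => .comp (.tensor (op_nf A _) (op_nf B _)) (op_join_hom ..)
  | L A, D => by
    by_cases hD : D A.count
    · rw [nf_L_of_mem hD]
      exact .rightUnitor_inv _
    · rw [nf_L_of_notMem hD]
      exact .comp (.eps A) (op_nf A D)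

theorem gr_join_inv (Γ Δ : List (MSco P)) {x y : ℕ} :
    gr (join Γ Δ).inv x y ↔ x = y ∧ x < (prod (Γ ++ Δ)).count := by
  induction Γ generalizing x y with
  | nil => exact Iff.rfl
  | cons A Γ ih =>
    change gr (A ◁ (join Γ Δ).inv ≫ (α_ A (prod Γ) (prod Δ)).inv) x y ↔
      x = y ∧ x < (A ⊗ prod (Γ ++ Δ)).count
    have hc := count_prod_append Γ Δ
    simp only [gr_comp, ← id_tensorHom, gr_tensor, gr_associator_inv, ih, gr_id, count_tensor, hc]
    constructor
    · rintro ⟨_, ⟨rfl, h⟩ | ⟨i, _, ⟨rfl, h⟩, rfl, rfl⟩, rfl, h'⟩ <;> omega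
    · rintro ⟨rfl, h⟩
      refine ⟨x, ?_, rfl, by omega⟩
      by_cases hx : x < (prod Δ).count + (prod Γ).count
      · exact .inl ⟨rfl, hx⟩
      · exact .inr ⟨_, _, ⟨rfl, by omega⟩, (Nat.add_sub_of_le (not_lt.1 hx)).symm,
          (Nat.add_sub_of_le (not_lt.1 hx)).symm⟩

theorem gr_join_hom (Γ Δ : List (MSco P)) {x : ℕ} (hx : x < (prod (Γ ++ Δ)).count) :
    gr (join Γ Δ).hom x x := by
  have : gr ((join Γ Δ).inv ≫ (join Γ Δ).hom) x x := by
    rw [Iso.inv_hom_id]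
    exact ⟨rfl, hx⟩
  obtain ⟨y, h, h'⟩ := (gr_comp ..).1 this
  obtain ⟨rfl, -⟩ := (gr_join_inv ..).1 h
  exact h'

/-- An entry of the list is a letter or a box kept because its outermost `L` is in `D`. Numbering
runs from right to left, so the outermost `L` of the head has the largest number, the count minus
one. -/
theorem nf_head : (X : MSco P) → (D : ℕ → Prop) → {A : MSco P} → {Δ : List (MSco P)} →
    (nf X D).1 = A :: Δ → 1 ≤ A.letters ∨ (1 ≤ A.count ∧
      ∃ x, D x ∧ gr (nf X D).2 x ((prod (nf X D).1).count - 1))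
  | of p, _, A, Δ, h => by
    obtain ⟨rfl, -⟩ := List.cons.inj h
    exact .inl le_rfl
  | unit, _, A, Δ, h => by cases h
  | tensor B C, D, A, Δ, h => by
    have hB := @nf_head B (fun i => D (C.count + i)) A
    have hC := @nf_head C D A Δ
    change (nf (B ⊗ C) D).1 = _ at h
    change _ ∨ (_ ∧ ∃ x, _ ∧ gr (nf (B ⊗ C) D).2 x ((prod (nf (B ⊗ C) D).1).count - 1))
    rw [nf_tensor] at h ⊢
    generalize (nf B fun i => D (C.count + i)) = s at *
    generalize nf C D = t at *
    obtain ⟨Γ, n⟩ := s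
    obtain ⟨Θ, m⟩ := t
    simp only [Norm.tens] at h hB hC ⊢
    have hc := count_prod_append Γ Θ
    cases Γ with
    | nil =>
      refine (hC h).imp_right ?_
      rintro ⟨h₁, x, hx, hm⟩
      exact ⟨h₁, x, hx, (gr_comp ..).2 ⟨_, (gr_tensor ..).2 (.inl hm),
        gr_join_hom [] Θ (gr_lt hm).2⟩⟩
    | cons A' Γ =>
      obtain ⟨rfl, -⟩ := List.cons.inj h
      refine (hB rfl).imp_right ?_
      rintro ⟨h₁, x, hx, hn⟩
      refine ⟨h₁, _, hx, (gr_comp ..).2 ⟨_, (gr_tensor ..).2 (.inr ⟨_, _, hn, rfl, rfl⟩), ?_⟩⟩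
      have := (gr_lt hn).2
      rw [hc, Nat.add_sub_assoc (by omega)]
      exact gr_join_hom _ _ (by omega)
  | L B, D, A, Δ, h => by
    have hB := @nf_head B D A Δ
    by_cases hD : D B.count
    · rw [nf_L_of_mem hD] at h ⊢
      obtain ⟨rfl, -⟩ := List.cons.inj h
      exact .inr ⟨Nat.le_add_left _ _, _, hD,
        (gr_rightUnitor_inv B.L _ _).2 ⟨(Nat.zero_add _).symm, Nat.lt_succ_self _⟩⟩
    · rw [nf_L_of_notMem hD] at h ⊢
      refine (hB h).imp_right ?_
      rintro ⟨h₁, x, hx, hn⟩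
      exact ⟨h₁, x, hx, (gr_comp ..).2 ⟨x, (gr_eps ..).2 ⟨rfl, (gr_lt hn).1⟩, hn⟩⟩

/-! ### Coalgebra structure of lists of boxes -/

theorem coact_nil_aux {X : MSco P} (c : X ⟶ X.L) :
    (psiUnit ⊗ₘ c) ≫ psi (𝟙_ _) X ≫ box (λ_ X).hom = (λ_ X).hom ≫ c := by
  rw [← leftUnitor_naturality, ← psi_left, tensorHom_def', Category.assoc]

theorem coact_single_aux {A : MSco P} (c : A ⟶ A.L) :
    (ρ_ A).inv ≫ (c ⊗ₘ psiUnit) ≫ psi A (𝟙_ _) = c ≫ box (ρ_ A).inv := by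
  have h : A.L ◁ psiUnit ≫ psi A (𝟙_ _) = (ρ_ A.L).hom ≫ box (ρ_ A).inv := by
    rw [← psi_right, Category.assoc, Category.assoc, ← box_comp, Iso.hom_inv_id, box_id,
      Category.comp_id]
  rw [MonoidalCategory.tensorHom_def, Category.assoc, h, ← rightUnitor_inv_naturality_assoc,
    Iso.inv_hom_id_assoc]

theorem coact_cons_aux {A X Y Z : MSco P} (cA : A ⟶ A.L) (cX : X ⟶ X.L) (cY : Y ⟶ Y.L)
    (cZ : Z ⟶ Z.L) (j : X ⊗ Y ⟶ Z) (h : (cX ⊗ₘ cY) ≫ psi X Y ≫ box j = j ≫ cZ) :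
    (((cA ⊗ₘ cX) ≫ psi A X) ⊗ₘ cY) ≫ psi (A ⊗ X) Y ≫ box ((α_ A X Y).hom ≫ A ◁ j) =
      ((α_ A X Y).hom ≫ A ◁ j) ≫ (cA ⊗ₘ cZ) ≫ psi A Z := by
  have h₁ : ((cA ⊗ₘ cX) ≫ psi A X) ⊗ₘ cY = ((cA ⊗ₘ cX) ⊗ₘ cY) ≫ psi A X ▷ Y.L := by
    rw [← tensorHom_id, tensorHom_comp_tensorHom, Category.comp_id]
  have h₂ : psi A (X ⊗ Y) ≫ box (A ◁ j) = A.L ◁ box j ≫ psi A Z := by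
    rw [← id_tensorHom, ← psi_natural, box_id, id_tensorHom]
  have h₃ : A ◁ j ≫ (cA ⊗ₘ cZ) = (cA ⊗ₘ (cX ⊗ₘ cY)) ≫ A.L ◁ psi X Y ≫ A.L ◁ box j := by
    rw [← whiskerLeft_comp, ← id_tensorHom, ← id_tensorHom, tensorHom_comp_tensorHom,
      tensorHom_comp_tensorHom, Category.id_comp, Category.comp_id, h]
  rw [h₁, box_comp, Category.assoc, reassoc_of% psi_assoc, h₂, associator_naturality_assoc,
    Category.assoc, reassoc_of% h₃]

/-- `join` is a coalgebra morphism: the empty list needs the left unit law of `psi`, a longer list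
its associativity and naturality. -/
theorem join_coact : (Γ Δ : List (MSco P)) → (hΓ : (prod Γ).Boxed) → (hΔ : (prod Δ).Boxed) →
    ∃ h : (prod (Γ ++ Δ)).Boxed,
      (coact _ hΓ ⊗ₘ coact _ hΔ) ≫ psi _ _ ≫ box (join Γ Δ).hom = (join Γ Δ).hom ≫ coact _ h
  | [], Δ, _, hΔ => ⟨hΔ, coact_nil_aux _⟩
  | A :: Γ, Δ, hΓ, hΔ => by
    obtain ⟨h, e⟩ := join_coact Γ Δ hΓ.2 hΔ
    exact ⟨⟨hΓ.1, h⟩, coact_cons_aux _ _ _ _ _ e⟩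

/-- All the outermost boxes of a formula belong to `D`. -/
def AllTop : MSco P → (ℕ → Prop) → Prop
  | of _, _ => True
  | unit, _ => True
  | tensor A B, D => AllTop A (fun i => D (B.count + i)) ∧ AllTop B D
  | L A, D => D A.count

theorem tens_coact_aux {X Y X' Y' Z : MSco P} (n : X ⟶ X') (m : Y ⟶ Y') (j : X' ⊗ Y' ⟶ Z)
    {cX : X ⟶ X.L} {cY : Y ⟶ Y.L} {cX' : X' ⟶ X'.L} {cY' : Y' ⟶ Y'.L} {cZ : Z ⟶ Z.L}
    (hn : n ≫ cX' = cX ≫ box n) (hm : m ≫ cY' = cY ≫ box m)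
    (hj : (cX' ⊗ₘ cY') ≫ psi X' Y' ≫ box j = j ≫ cZ) :
    ((n ⊗ₘ m) ≫ j) ≫ cZ = ((cX ⊗ₘ cY) ≫ psi X Y) ≫ box ((n ⊗ₘ m) ≫ j) := by
  rw [Category.assoc, Category.assoc, ← hj, box_comp, ← reassoc_of% psi_natural,
    tensorHom_comp_tensorHom_assoc, tensorHom_comp_tensorHom_assoc, hn, hm]

/-- When no box has to be opened, `nf` only flattens, so it is an isomorphism of coalgebras. -/
theorem nf_coact : (Y : MSco P) → (D : ℕ → Prop) → (h : Y.Boxed) → AllTop Y D →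
    IsIso (nf Y D).2 ∧ ∃ h' : (prod (nf Y D).1).Boxed,
      (nf Y D).2 ≫ coact _ h' = coact Y h ≫ box (nf Y D).2
  | of _, _, h, _ => h.elim
  | unit, _, _, _ => ⟨inferInstanceAs (IsIso (𝟙 (𝟙_ (MSco P)))), trivial, by
      change 𝟙 (𝟙_ _) ≫ psiUnit = psiUnit ≫ box (𝟙 (𝟙_ _))
      rw [box_id, Category.comp_id, Category.id_comp]⟩
  | tensor A B, D, h, hD => by
    obtain ⟨hA, hA', eA⟩ := nf_coact A _ h.1 hD.1
    obtain ⟨hB, hB', eB⟩ := nf_coact B _ h.2 hD.2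
    obtain ⟨hj, ej⟩ := join_coact _ _ hA' hB'
    refine ⟨?_, hj, tens_coact_aux _ _ _ eA eB ej⟩
    change IsIso (((nf A fun i => D (B.count + i)).2 ⊗ₘ (nf B D).2) ≫ (join _ _).hom)
    infer_instance
  | L A, D, _, hD => by
    rw [nf_L_of_mem hD]
    exact ⟨inferInstanceAs (IsIso (ρ_ A.L).inv), ⟨trivial, trivial⟩, coact_single_aux (del A)⟩

/-- `Y.count` is the number of the outermost `L` of `Y.L`, and `coact` links all outermost boxes of
`Y` to it. -/
theorem allTop_of_coact : (Y : MSco P) → (D : ℕ → Prop) → (h : Y.Boxed) →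
    (∀ y, gr (coact Y h) y Y.count → D y) → AllTop Y D
  | of _, _, _, _ => trivial
  | unit, _, _, _ => trivial
  | L A, _, _, hD => hD _ (.inr ⟨rfl, .inr rfl⟩)
  | tensor A B, D, h, hD => by
    have key : ∀ y, (gr (coact B h.2) y B.count ∨
        ∃ i, gr (coact A h.1) i A.count ∧ y = B.count + i) → D y := by
      intro y hy
      refine hD y ((gr_comp ..).2 ?_)
      rcases hy with hy | ⟨i, hi, rfl⟩
      · exact ⟨_, (gr_tensor ..).2 (.inl hy), .inr (.inr ⟨.inl rfl, rfl⟩)⟩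
      · exact ⟨_, (gr_tensor ..).2 (.inr ⟨i, _, hi, rfl, rfl⟩), .inr (.inr ⟨.inr rfl, rfl⟩)⟩
    exact ⟨allTop_of_coact A _ h.1 fun i hi => key _ (.inr ⟨i, hi, rfl⟩),
      allTop_of_coact B _ h.2 fun y hy => key _ (.inl hy)⟩

/-! ### Factorization through the normalization of the source -/

/-- The occurrences of `L` in the source that are linked to some occurrence in the target. -/
def dom {A B : MSco P} (f : A ⟶ B) (x : ℕ) : Prop := ∃ z, gr f x z

theorem Op.nf_dom {X Y B : MSco P} {e : X ⟶ Y} (he : Op e) (f : Y ⟶ B) :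
    nf X (dom (e ≫ f)) = .pre e (nf Y (dom f)) := by
  refine (he.pre_nf fun x _ => ?_).symm
  simp only [dom, gr_comp]
  grind

theorem nf_dom_tensor {X Y B C : MSco P} (f : X ⟶ B) (g : Y ⟶ C) :
    nf (X ⊗ Y) (dom (f ⊗ₘ g)) = .tens (nf X (dom f)) (nf Y (dom g)) := by
  rw [nf_tensor]
  congr 1
  · refine nf_congr X fun x hx => ?_
    simp only [dom, gr_tensor]
    constructor
    · rintro ⟨z, h | ⟨i, j, h, hi, rfl⟩⟩
      · have := (gr_lt h).1
        omega
      · obtain rfl : x = i := by omega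
        exact ⟨j, h⟩
    · rintro ⟨z, h⟩
      exact ⟨_, .inr ⟨_, _, h, rfl, rfl⟩⟩
  · refine nf_congr Y fun x hx => ?_
    simp only [dom, gr_tensor]
    constructor
    · rintro ⟨z, h | ⟨i, j, h, hi, rfl⟩⟩
      · exact ⟨z, h⟩
      · omega
    · rintro ⟨z, h⟩
      exact ⟨_, .inl h⟩

theorem Op.nf_dom_self {X B : MSco P} {f : X ⟶ B} (hf : Op f) :
    nf X (dom f) = .pre f (nf B fun _ => True) := by
  refine (hf.pre_nf fun x _ => ?_).symm
  simp only [dom, and_true]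

theorem exists_comp_box {Y Z B : MSco P} {n : Y ⟶ Z} (hn : IsIso n) {cY : Y ⟶ Y.L}
    {cZ : Z ⟶ Z.L} (h : n ≫ cZ = cY ≫ box n) (g : Y ⟶ B) :
    ∃ g' : Z ⟶ B, cY ≫ box g = n ≫ cZ ≫ box g' :=
  ⟨inv n ≫ g, by rw [reassoc_of% h, ← box_comp, IsIso.hom_inv_id_assoc]⟩

/-- In the reduced form of `f`, all outermost boxes of `Y` are linked, so flattening `Y` is an
isomorphism of coalgebras, along which the promotion is transported. -/
theorem factor_box {X B : MSco P} (f : X ⟶ B.L) :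
    ∃ (h : (prod (nf X (dom f)).1).Boxed) (g : prod (nf X (dom f)).1 ⟶ B),
      f = (nf X (dom f)).2 ≫ coact _ h ≫ box g := by
  obtain ⟨Y, hY, e, g, he, -, rfl⟩ := red f
  have hD : AllTop Y (dom (coact Y hY ≫ box g)) := allTop_of_coact Y _ hY fun y hy =>
    ⟨_, (gr_comp ..).2 ⟨_, hy, (gr_box ..).2 (.inr ⟨rfl, rfl⟩)⟩⟩
  obtain ⟨hi, h', e'⟩ := nf_coact Y _ hY hD
  obtain ⟨g', hg⟩ := exists_comp_box hi e' g
  rw [he.nf_dom]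
  exact ⟨h', g', (congrArg (e ≫ ·) hg).trans (Category.assoc _ _ _).symm⟩

theorem factor : (B : MSco P) → {X : MSco P} → (f : X ⟶ B) →
    ∃ g : prod (nf X (dom f)).1 ⟶ B, f = (nf X (dom f)).2 ≫ g
  | of p, X, f => by
    rw [(show Op f from red f).nf_dom_self]
    refine ⟨(ρ_ (of p)).hom, ?_⟩
    change f = (f ≫ (ρ_ (of p)).inv) ≫ (ρ_ (of p)).hom
    rw [Category.assoc, Iso.inv_hom_id, Category.comp_id]
  | unit, X, f => by
    rw [(show Op f from red f).nf_dom_self]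
    refine ⟨𝟙 unit, ?_⟩
    change f = (f ≫ 𝟙 unit) ≫ 𝟙 unit
    rw [Category.comp_id, Category.comp_id]
  | tensor B C, X, f => by
    obtain ⟨Y, Z, e, g, k, he, -, -, rfl⟩ := red f
    obtain ⟨g', hg⟩ := factor B g
    obtain ⟨k', hk⟩ := factor C k
    erw [he.nf_dom]
    rw [nf_dom_tensor]
    refine ⟨(join _ _).inv ≫ (g' ⊗ₘ k'), ?_⟩
    change e ≫ (g ⊗ₘ k) = (e ≫ ((nf Y (dom g)).2 ⊗ₘ (nf Z (dom k)).2) ≫ (join _ _).hom) ≫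
      (join _ _).inv ≫ (g' ⊗ₘ k')
    rw [Category.assoc, Category.assoc, Iso.hom_inv_id_assoc, tensorHom_comp_tensorHom, ← hg, ← hk]
  | L B, X, f => by
    obtain ⟨h, g, hf⟩ := factor_box f
    exact ⟨_, hf⟩

/-- The cut of the list comes from the two components of the reduced form. The last clause records
why the first entry on the right belongs there, which is what `split_unique` needs. -/
theorem factor_tensor {X B C : MSco P} (f : X ⟶ B ⊗ C) :
    ∃ (Γ Δ : List (MSco P)) (n : X ⟶ prod (Γ ++ Δ)) (g : prod Γ ⟶ B) (k : prod Δ ⟶ C),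
      nf X (dom f) = ⟨Γ ++ Δ, n⟩ ∧ f = n ≫ (join Γ Δ).inv ≫ (g ⊗ₘ k) ∧
      ∀ A Θ, Δ = A :: Θ →
        1 ≤ A.letters ∨ (1 ≤ A.count ∧ ∃ z, gr k ((prod Δ).count - 1) z) := by
  obtain ⟨Y, Z, e, g, k, he, -, -, rfl⟩ := red f
  obtain ⟨g', hg⟩ := factor B g
  obtain ⟨k', hk⟩ := factor C k
  refine ⟨_, _, e ≫ ((nf Y (dom g)).2 ⊗ₘ (nf Z (dom k)).2) ≫ (join _ _).hom, g', k', ?_, ?_, ?_⟩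
  · exact (he.nf_dom (g ⊗ₘ k)).trans (congrArg (Norm.pre e) (nf_dom_tensor g k))
  · rw [Category.assoc, Category.assoc, Iso.hom_inv_id_assoc, tensorHom_comp_tensorHom, ← hg, ← hk]
  · intro A Θ h
    refine (nf_head Z (dom k) h).imp_right (And.imp_right ?_)
    rintro ⟨x, ⟨z, hz⟩, hx⟩
    rw [hk] at hz
    obtain ⟨y, hy, hz⟩ := (gr_comp ..).1 hz
    -- The link of `k` from `x` passes through the only image of `x` under the normalization, which
    -- is the outermost `L` of the head.
    obtain rfl := (op_nf Z _).functional hy hx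
    exact ⟨z, hz⟩

/-! ### Faithfulness -/

/-- A disputed entry, the head of `Θ`, would go to `C` in one cut and to `B` in the other. A letter
in it contradicts the letter count of `B`; a link from its outermost `L` would have to end both in
`C` and in `B`. -/
theorem split_unique {X B C : MSco P} {Γ Θ Δ : List (MSco P)} {n : X ⟶ prod (Γ ++ (Θ ++ Δ))}
    {m : X ⟶ prod ((Γ ++ Θ) ++ Δ)} (hn : Op n) (hnm : gr n = gr m) {g : prod Γ ⟶ B}
    {k : prod (Θ ++ Δ) ⟶ C} {g' : prod (Γ ++ Θ) ⟶ B} {k' : prod Δ ⟶ C}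
    (h : gr (n ≫ (join _ _).inv ≫ (g ⊗ₘ k)) = gr (m ≫ (join _ _).inv ≫ (g' ⊗ₘ k')))
    (hk : ∀ A Ξ, Θ ++ Δ = A :: Ξ →
      1 ≤ A.letters ∨ (1 ≤ A.count ∧ ∃ z, gr k ((prod (Θ ++ Δ)).count - 1) z)) : Θ = [] := by
  cases Θ with
  | nil => rfl
  | cons A Ξ =>
    exfalso
    rcases hk A _ rfl with hA | ⟨hA, z, hz⟩
    · have h₁ := (letters_eq g).trans (letters_eq g').symm
      have h₂ : (prod (A :: Ξ)).letters = A.letters + (prod Ξ).letters := rfl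
      rw [letters_prod_append] at h₁
      omega
    · have hc : (prod (A :: Ξ ++ Δ)).count = (prod (Ξ ++ Δ)).count + A.count := rfl
      have hc' := count_prod_append Ξ Δ
      have hc'' := count_prod_append Γ (A :: Ξ ++ Δ)
      generalize hy : (prod (A :: Ξ ++ Δ)).count - 1 = y at hz
      obtain ⟨x, hx⟩ := hn.surjective (y := y) (by omega)
      have h₁ : gr (n ≫ (join _ _).inv ≫ (g ⊗ₘ k)) x z :=
        (gr_comp ..).2 ⟨y, hx, (gr_comp ..).2 ⟨y, (gr_join_inv ..).2 ⟨rfl, by omega⟩,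
          (gr_tensor ..).2 (.inl hz)⟩⟩
      rw [h] at h₁
      obtain ⟨y', hy', h₁⟩ := (gr_comp ..).1 h₁
      rw [← hnm] at hy'
      obtain rfl := hn.functional hx hy'
      obtain ⟨y', hy', h₁⟩ := (gr_comp ..).1 h₁
      obtain ⟨rfl, -⟩ := (gr_join_inv ..).1 hy'
      -- For the second cut, `y` is too large to lie in `Δ`, and `z` is too small to lie in `B`.
      rcases (gr_tensor ..).1 h₁ with h₁ | ⟨i, j, -, -, rfl⟩
      · have := (gr_lt h₁).1
        omega
      · have := (gr_lt hz).2
        omega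

theorem gr_tensor_imp {A A' B B' : MSco P} {f f' : A ⟶ A'} {g g' : B ⟶ B'}
    (h : gr (f ⊗ₘ g) = gr (f' ⊗ₘ g')) :
    (∀ x y, gr f x y → gr f' x y) ∧ ∀ x y, gr g x y → gr g' x y := by
  constructor
  · intro x y hf
    have : gr (f' ⊗ₘ g') (B.count + x) (B'.count + y) :=
      h ▸ (gr_tensor ..).2 (.inr ⟨x, y, hf, rfl, rfl⟩)
    rcases (gr_tensor ..).1 this with h' | ⟨i, j, h', hi, hj⟩
    · have := (gr_lt h').1
      omega
    · rwa [Nat.add_left_cancel hi, Nat.add_left_cancel hj]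
  · intro x y hg
    have : gr (f' ⊗ₘ g') x y := h ▸ (gr_tensor ..).2 (.inl hg)
    rcases (gr_tensor ..).1 this with h' | ⟨i, j, h', rfl, rfl⟩
    · exact h'
    · have := (gr_lt hg).1
      omega

theorem gr_tensor_inj {A A' B B' : MSco P} {f f' : A ⟶ A'} {g g' : B ⟶ B'}
    (h : gr (f ⊗ₘ g) = gr (f' ⊗ₘ g')) : gr f = gr f' ∧ gr g = gr g' :=
  ⟨funext₂ fun x y => propext
      ⟨(gr_tensor_imp h).1 x y, (gr_tensor_imp h.symm).1 x y⟩,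
    funext₂ fun x y => propext
      ⟨(gr_tensor_imp h).2 x y, (gr_tensor_imp h.symm).2 x y⟩⟩

theorem dom_congr {A B : MSco P} {f g : A ⟶ B} (h : gr f = gr g) : dom f = dom g := by
  unfold dom
  rw [h]

/-- Both openings, followed by the full opening of `B`, give the normalization of `X` determined by
their common graph; an invertible full opening can be cancelled. -/
theorem Op.eq_of_gr_eq {X B : MSco P} {f g : X ⟶ B} (hf : Op f) (hg : Op g)
    (hB : IsIso (nf B fun _ => True).2) (h : gr f = gr g) : f = g := by
  have := hf.nf_dom_self
  rw [dom_congr h, hg.nf_dom_self] at this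
  exact ((cancel_mono (nf B fun _ => True).2).1 (eq_of_heq (Sigma.mk.inj this).2)).symm

theorem eq_of_gr_eq : (B : MSco P) → {X : MSco P} → (f g : X ⟶ B) → gr f = gr g → f = g
  | of p, X, f, g, h =>
    (show Op f from red f).eq_of_gr_eq (red g) (inferInstanceAs (IsIso (ρ_ (of p)).inv)) h
  | unit, X, f, g, h =>
    (show Op f from red f).eq_of_gr_eq (red g) (inferInstanceAs (IsIso (𝟙 unit))) h
  | tensor B C, X, f, g, h => by
    have ihB := @eq_of_gr_eq B
    have ihC := @eq_of_gr_eq C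
    obtain ⟨Γ, Δ, n, a, b, hn, hf, hb⟩ := factor_tensor f
    obtain ⟨Γ', Δ', n', a', b', hn', hg, hb'⟩ := factor_tensor g
    have hop : Op n := by
      have := op_nf X (dom f)
      rwa [hn] at this
    have hop' : Op n' := by
      have := op_nf X (dom g)
      rwa [hn'] at this
    have hs : (⟨Γ ++ Δ, n⟩ : Norm X) = ⟨Γ' ++ Δ', n'⟩ := by rw [← hn, ← hn', dom_congr h]
    have hgr : gr n = gr n' := congrArg (fun s : Norm X => gr s.2) hs
    have hgr' : gr (n ≫ (join Γ Δ).inv ≫ (a ⊗ₘ b)) = gr (n' ≫ (join Γ' Δ').inv ≫ (a' ⊗ₘ b')) := by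
      rw [← hf, ← hg]
      exact h
    have key : Γ = Γ' ∧ Δ = Δ' := by
      rcases List.append_eq_append_iff.1 (congrArg Sigma.fst hs) with
        ⟨Θ, rfl, rfl⟩ | ⟨Θ, rfl, rfl⟩
      · obtain rfl := split_unique hop hgr hgr' hb
        exact ⟨(List.append_nil _).symm, rfl⟩
      · obtain rfl := split_unique hop' hgr.symm hgr'.symm hb'
        exact ⟨List.append_nil _, rfl⟩
    obtain ⟨rfl, rfl⟩ := key
    obtain rfl := eq_of_heq (Sigma.mk.inj hs).2
    rw [← Category.assoc, ← Category.assoc] at hgr'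
    obtain ⟨ha, hb⟩ := gr_tensor_inj ((hop.comp (op_join_inv Γ Δ)).gr_cancel hgr')
    rw [hf, hg, ihB _ _ ha, ihC _ _ hb]
  | L B, X, f, g, h => by
    have ih := @eq_of_gr_eq B
    obtain ⟨hf, a, ha⟩ := factor_box f
    have := factor_box g
    rw [← dom_congr h] at this
    obtain ⟨hg, b, hb⟩ := this
    have hab : gr (coact _ hf ≫ box a) = gr (coact _ hf ≫ box b) :=
      (op_nf X (dom f)).gr_cancel (by rw [← ha, ← hb, h])
    have : gr a = gr b := by
      -- Only the graphs of the promoted arrows are known to agree; composing with the counit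
      -- recovers those of `a` and `b`.
      rw [← promote_eps hf a, ← promote_eps hf b, ← Category.assoc, ← Category.assoc]
      funext x y
      simp only [gr_comp _ (eps B), hab]
    rw [ha, hb, ih _ _ this]

end MSco

theorem mainTheorem2 (P : Type u) : (MSco.G P).Faithful := by
  refine ⟨fun {A B f g} h => MSco.eq_of_gr_eq B f g ?_⟩
  have key : ∀ (f : A ⟶ B) (x : Fin A.count) (y : Fin B.count),
      (x, y) ∈ ((MSco.G P).map f).rel ↔ MSco.gr f x y := by
    rintro ⟨f⟩ x y
    exact Iff.rfl
  have imp : ∀ {f g : A ⟶ B}, (MSco.G P).map f = (MSco.G P).map g →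
      ∀ x y, MSco.gr f x y → MSco.gr g x y := by
    intro f g h x y hf
    have hf' := (key f ⟨x, (MSco.gr_lt hf).1⟩ ⟨y, (MSco.gr_lt hf).2⟩).2 hf
    rw [h] at hf'
    exact (key g _ _).1 hf'
  exact funext₂ fun x y => propext ⟨imp h x y, imp h.symm x y⟩
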